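/- Let $q\in\mathbb C$ with $|q|=1$, $q$ not a root of unity, fix a square root $q^{1/2}$ of $q$, and write $[n]_q=\frac{q^n-q^{-n}}{q-q^{-1}}$, $[n]_q!=[1]_q\cdots[n]_q$. Let $\mathcal A=SL_q(2,\mathbb R)$ be the unital complex $*$-algebra generated by self-adjoint elements $a,b,c,d$ with relations $$ab=q\,ba,\quad ac=q\,ca,\quad bc=cb,\quad bd=q\,db,\quad cd=q\,dc,\quad da-q^{-1}bc=1=ad-q\,bc,$$ with the Hopf algebra structure $\Delta\begin{pmatrix}a&b\\c&d\end{pmatrix}=\begin{pmatrix}a&b\\c&d\end{pmatrix}\otimes\begin{pmatrix}a&b\\c&d\end{pmatrix}$, $\varepsilon\begin{pmatrix}a&b\\c&d\end{pmatrix}=\begin{pmatrix}1&0\\0&1\end{pmatrix}$, $S\begin{pmatrix}a&b\\c&d\end{pmatrix}=\begin{pmatrix}d&-q^{-1}b\\-q\,c&a\end{pmatrix}$, and let $\tau=*\circ S$. Let $\mu\in\mathbb R\setminus\{0\}$ and $\nu=\mu^2$. The space $\mathcal C=\mathrm{Span}\{a-d+2q^{1/2}\mu\,b,\ q\nu\,b+c\}$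 is a $\tau$-invariant two-sided coideal; let $\mathbf R_q=\mathcal A/\mathcal C\mathcal A$ be the quotient of $\mathcal A$ by the right ideal generated by $\mathcal C$, with its quotient structures of coalgebra and right $\mathcal A$-module (denoted $\cdot$), with the conjugate-linear map $\tau$ induced on it, and with quotient map $r$. Put $$v_n=r\big[(a+q^{1/2}\mu b)(a+q^{3/2}\mu b)\cdots(a+q^{n-1/2}\mu b)\big]\quad(n\ge 0,\ v_0=r[1]),$$ $$X_n=\sum_{i=1}^n\frac{(q-q^{-1})^{i-1}q^{i/2}\mu^i\,[n-1]_q!}{[i]_q\,[n-i]_q!}\;v_{n-i}\cdot b^i\quad(n\ge1).$$ (i) Let $\mathbf R_q^{(0)}=\mathrm{Span}\{v_0\}$ and $\mathbf R_q^{(n)}=\mathrm{Span}\{v_n,X_n\}$ for $n>0$. Each $\mathbf R_q^{(n)}$ is a cocommutative subcoalgebra of $\mathbf R_q$, and $\mathbf R_q=\bigoplus_{n\in\mathbb N}\mathbf R_q^{(n)}$. (ii) Every $v_n$ is group-like, and the simple subcoalgebras of $\mathbf R_q$ are exactly the lines $\mathrm{Span}\{v_n\}$, $n\in\mathbb N$;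 in particular $\mathbf R_q$ is pointed (all its simple subcoalgebras are one-dimensional). The corresponding one-dimensional corepresentations $\rho_n:\mathbb C\to\mathbb C\otimes\mathbf R_q$, $\rho_n(1)=1\otimes v_n$, are unitary. Here a corepresentation on an inner product space with matrix coefficients $\rho_{ij}$ in an orthonormal basis is called unitary if $\tau(\rho_{ij})=\rho_{ji}$ for all $i,j$. (iii) No complex Hopf algebra is isomorphic to $\mathbf R_q$ as a coalgebra. -/

import Mathlib

open scoped TensorProduct ComplexConjugate

set_option linter.unusedSimpArgs false

noncomputable section

/-! ### The quantum group `SL_q(2, ℝ)` as a Hopf algebra with involution, for `|q| = 1` -/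

namespace QuantumSL2

/-- The four generators. -/
inductive Gen : Type
  | a | b | c | d

open Gen

/-- The generators in the free algebra. -/
abbrev fr (g : Gen) : FreeAlgebra ℂ Gen := FreeAlgebra.ι ℂ g

/-- The defining relations of `SL_q(2)`. -/
inductive Rel (q : Circle) : FreeAlgebra ℂ Gen → FreeAlgebra ℂ Gen → Prop
  | ab : Rel q (fr a * fr b) ((q : ℂ) • (fr b * fr a))
  | ac : Rel q (fr a * fr c) ((q : ℂ) • (fr c * fr a))
  | bc : Rel q (fr b * fr c) (fr c * fr b)
  | bd : Rel q (fr b * fr d) ((q : ℂ) • (fr d * fr b))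
  | cd : Rel q (fr c * fr d) ((q : ℂ) • (fr d * fr c))
  | da : Rel q (fr d * fr a - (q : ℂ)⁻¹ • (fr b * fr c)) 1
  | ad : Rel q (fr a * fr d - (q : ℂ) • (fr b * fr c)) 1

/-- The function algebra on `SL_q(2, ℝ)`: the unital complex algebra generated by `a, b, c, d`
subject to the relations `Rel`. -/
def SLq (q : Circle) : Type := RingQuot (Rel q)

namespace SLq

variable {q : Circle}

instance : Ring (SLq q) := inferInstanceAs (Ring (RingQuot (Rel q)))
instance : Algebra ℂ (SLq q) := inferInstanceAs (Algebra ℂ (RingQuot (Rel q)))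

variable (q) in
/-- The quotient map from the free algebra. -/
def mk : FreeAlgebra ℂ Gen →ₐ[ℂ] SLq q := RingQuot.mkAlgHom ℂ (Rel q)

variable (q) in
/-- The image of a generator. -/
def gen (g : Gen) : SLq q := mk q (fr g)

theorem mk_rel {x y : FreeAlgebra ℂ Gen} (h : Rel q x y) : mk q x = mk q y :=
  RingQuot.mkAlgHom_rel ℂ h

theorem rel_ab : gen q a * gen q b = (q : ℂ) • (gen q b * gen q a) := by
  simpa [gen] using mk_rel (Rel.ab (q := q))
theorem rel_ac : gen q a * gen q c = (q : ℂ) • (gen q c * gen q a) := by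
  simpa [gen] using mk_rel (Rel.ac (q := q))
theorem rel_bc : gen q b * gen q c = gen q c * gen q b := by
  simpa [gen] using mk_rel (Rel.bc (q := q))
theorem rel_bd : gen q b * gen q d = (q : ℂ) • (gen q d * gen q b) := by
  simpa [gen] using mk_rel (Rel.bd (q := q))
theorem rel_cd : gen q c * gen q d = (q : ℂ) • (gen q d * gen q c) := by
  simpa [gen] using mk_rel (Rel.cd (q := q))
theorem rel_da : gen q d * gen q a - (q : ℂ)⁻¹ • (gen q b * gen q c) = 1 := by
  simpa [gen] using mk_rel (Rel.da (q := q))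
theorem rel_ad : gen q a * gen q d - (q : ℂ) • (gen q b * gen q c) = 1 := by
  simpa [gen] using mk_rel (Rel.ad (q := q))

/-- Induction on elements of `SL_q(2)`. -/
theorem induction {P : SLq q → Prop} (hs : ∀ z : ℂ, P (algebraMap ℂ _ z))
    (hg : ∀ g, P (gen q g)) (hm : ∀ x y, P x → P y → P (x * y))
    (ha : ∀ x y, P x → P y → P (x + y)) (x : SLq q) : P x := by
  obtain ⟨y, rfl⟩ : ∃ y, mk q y = x := RingQuot.mkAlgHom_surjective ℂ (Rel q) x
  induction y using FreeAlgebra.induction with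
  | grade0 z => simpa using hs z
  | grade1 g => exact hg g
  | mul x y hx hy => simpa using hm _ _ hx hy
  | add x y hx hy => simpa using ha _ _ hx hy

/-- The universal property of `SL_q(2)`. -/
def lift {B : Type*} [Ring B] [Algebra ℂ B] (f : Gen → B)
    (hab : f a * f b = (q : ℂ) • (f b * f a)) (hac : f a * f c = (q : ℂ) • (f c * f a))
    (hbc : f b * f c = f c * f b) (hbd : f b * f d = (q : ℂ) • (f d * f b))
    (hcd : f c * f d = (q : ℂ) • (f d * f c))
    (hda : f d * f a - (q : ℂ)⁻¹ • (f b * f c) = 1)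
    (had : f a * f d - (q : ℂ) • (f b * f c) = 1) : SLq q →ₐ[ℂ] B :=
  RingQuot.liftAlgHom ℂ ⟨FreeAlgebra.lift ℂ f, by
    intro x y h
    cases h <;> simp <;> assumption⟩

@[simp] theorem lift_gen {B : Type*} [Ring B] [Algebra ℂ B] (f : Gen → B)
    (hab hac hbc hbd hcd hda had) (g : Gen) :
    lift (q := q) f hab hac hbc hbd hcd hda had (gen q g) = f g := by
  simp only [lift, gen, mk, fr]
  erw [RingQuot.liftAlgHom_mkAlgHom_apply]
  simp

theorem algHom_ext {B : Type*} [Ring B] [Algebra ℂ B] {f g : SLq q →ₐ[ℂ] B}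
    (h : ∀ x, f (gen q x) = g (gen q x)) : f = g := by
  ext x
  induction x using induction with
  | hs z => simp
  | hg x => exact h x
  | hm x y hx hy => simp [hx, hy]
  | ha x y hx hy => simp [hx, hy]

/-- The coproduct on generators: the matrix `(a b; c d)` is multiplicative. -/
def comulGen (q : Circle) : Gen → SLq q ⊗[ℂ] SLq q
  | a => gen q a ⊗ₜ gen q a + gen q b ⊗ₜ gen q c
  | b => gen q a ⊗ₜ gen q b + gen q b ⊗ₜ gen q d
  | c => gen q c ⊗ₜ gen q a + gen q d ⊗ₜ gen q c
  | d => gen q c ⊗ₜ gen q b + gen q d ⊗ₜ gen q d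

/-- The counit on generators. -/
def counitGen : Gen → ℂ
  | a => 1
  | b => 0
  | c => 0
  | d => 1

/-- The antipode on generators, as an anti-homomorphism. -/
def antipodeGen (q : Circle) : Gen → (SLq q)ᵐᵒᵖ
  | a => .op (gen q d)
  | b => .op (-(q : ℂ)⁻¹ • gen q b)
  | c => .op (-(q : ℂ) • gen q c)
  | d => .op (gen q a)

theorem q_ne_zero : (q : ℂ) ≠ 0 := Circle.coe_ne_zero q

theorem da_eq : gen q d * gen q a = 1 + (q : ℂ)⁻¹ • (gen q b * gen q c) :=
  sub_eq_iff_eq_add.mp rel_da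
theorem ad_eq : gen q a * gen q d = 1 + (q : ℂ) • (gen q b * gen q c) :=
  sub_eq_iff_eq_add.mp rel_ad

variable (q) in
/-- The coproduct of `SL_q(2)`. -/
def comulHom : SLq q →ₐ[ℂ] SLq q ⊗[ℂ] SLq q := by
  refine lift (comulGen q) ?_ ?_ ?_ ?_ ?_ ?_ ?_ <;>
  · have hq := q_ne_zero (q := q)
    simp only [comulGen, mul_add, add_mul, Algebra.TensorProduct.tmul_mul_tmul, rel_ab, rel_ac,
      ← rel_bc, rel_bd, rel_cd, da_eq, ad_eq, TensorProduct.tmul_smul, TensorProduct.tmul_add,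
      TensorProduct.add_tmul, ← TensorProduct.smul_tmul', smul_add, smul_smul,
      Algebra.TensorProduct.one_def]
    match_scalars <;> field_simp <;> ring

variable (q) in
/-- The counit of `SL_q(2)`. -/
def counitHom : SLq q →ₐ[ℂ] ℂ := by
  refine lift counitGen ?_ ?_ ?_ ?_ ?_ ?_ ?_ <;> simp [counitGen]

variable (q) in
/-- The antipode of `SL_q(2)` as an anti-homomorphism. -/
def antipodeHom : SLq q →ₐ[ℂ] (SLq q)ᵐᵒᵖ := by
  refine lift (antipodeGen q) ?_ ?_ ?_ ?_ ?_ ?_ ?_ <;>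
  · have hq := q_ne_zero (q := q)
    apply MulOpposite.unop_injective
    simp only [antipodeGen, MulOpposite.unop_mul, MulOpposite.unop_smul, MulOpposite.unop_op,
      MulOpposite.unop_sub, MulOpposite.unop_one, smul_mul_assoc, mul_smul_comm, rel_ab, rel_ac,
      ← rel_bc, rel_bd, rel_cd, da_eq, ad_eq, smul_smul]
    match_scalars <;> field_simp <;> ring

instance : Bialgebra ℂ (SLq q) :=
  Bialgebra.ofAlgHom (comulHom q) (counitHom q)
    (by
      refine algHom_ext fun x => ?_
      cases x <;>
        simp [comulHom, comulGen, TensorProduct.add_tmul, TensorProduct.tmul_add] <;> abel)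
    (by
      refine algHom_ext fun x => ?_
      cases x <;> simp [comulHom, counitHom, comulGen, counitGen])
    (by
      refine algHom_ext fun x => ?_
      cases x <;> simp [comulHom, counitHom, comulGen, counitGen])

@[simp] theorem comul_gen (g : Gen) : Coalgebra.comul (R := ℂ) (gen q g) = comulGen q g := by
  change comulHom q (gen q g) = _
  simp [comulHom]

@[simp] theorem counit_gen (g : Gen) : Coalgebra.counit (R := ℂ) (gen q g) = counitGen g := by
  change counitHom q (gen q g) = _
  simp [counitHom]

variable (q) in
/-- The antipode of `SL_q(2)` as a linear map. -/
def antipodeLin : SLq q →ₗ[ℂ] SLq q :=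
  (MulOpposite.opLinearEquiv ℂ).symm.toLinearMap ∘ₗ (antipodeHom q).toLinearMap

theorem antipodeLin_gen (g : Gen) : antipodeLin q (gen q g) = (antipodeGen q g).unop := by
  simp [antipodeLin, antipodeHom]

theorem antipodeLin_mul (x y : SLq q) :
    antipodeLin q (x * y) = antipodeLin q y * antipodeLin q x := by
  simp [antipodeLin]

theorem antipodeLin_algebraMap (z : ℂ) :
    antipodeLin q (algebraMap ℂ _ z) = algebraMap ℂ _ z := by
  simp [antipodeLin]

theorem mul_antipode_left_aux (t : SLq q ⊗[ℂ] SLq q) (x y : SLq q) :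
    LinearMap.mul' ℂ _ ((antipodeLin q).rTensor _ (t * x ⊗ₜ y)) =
      antipodeLin q x * LinearMap.mul' ℂ _ ((antipodeLin q).rTensor _ t) * y := by
  induction t with
  | zero => simp
  | tmul u v => simp [antipodeLin_mul, mul_assoc]
  | add u v hu hv => simp [add_mul, mul_add, hu, hv]

theorem mul_antipode_right_aux (t : SLq q ⊗[ℂ] SLq q) (x y : SLq q) :
    LinearMap.mul' ℂ _ ((antipodeLin q).lTensor _ (x ⊗ₜ y * t)) =
      x * LinearMap.mul' ℂ _ ((antipodeLin q).lTensor _ t) * antipodeLin q y := by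
  induction t with
  | zero => simp
  | tmul u v => simp [antipodeLin_mul, mul_assoc]
  | add u v hu hv => simp [add_mul, mul_add, hu, hv]

theorem mul_antipode_left (x : SLq q) :
    LinearMap.mul' ℂ _ ((antipodeLin q).rTensor _ (Coalgebra.comul x)) =
      algebraMap ℂ _ (Coalgebra.counit x) := by
  induction x using induction with
  | hs z => simp [Algebra.TensorProduct.algebraMap_apply, antipodeLin_algebraMap]
  | hg g =>
    have hq := q_ne_zero (q := q)
    cases g <;>
    · simp only [comul_gen, counit_gen, comulGen, counitGen, map_add, LinearMap.rTensor_tmul,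
        LinearMap.mul'_apply, antipodeLin_gen, antipodeGen, MulOpposite.unop_op, smul_mul_assoc,
        rel_ab, rel_ac, ← rel_bc, rel_bd, rel_cd, da_eq, ad_eq, map_one, map_zero]
      match_scalars <;> field_simp <;> ring
  | hm x y hx hy =>
    rw [Bialgebra.comul_mul, Bialgebra.counit_mul, map_mul (algebraMap _ _), ← hy]
    generalize Coalgebra.comul (R := ℂ) y = t
    induction t with
    | zero => simp
    | tmul u v =>
      rw [mul_antipode_left_aux, hx, ← Algebra.commutes, mul_assoc]
      simp
    | add u v hu hv => simp only [mul_add, map_add, hu, hv]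
  | ha x y hx hy => simp [hx, hy]

theorem mul_antipode_right (x : SLq q) :
    LinearMap.mul' ℂ _ ((antipodeLin q).lTensor _ (Coalgebra.comul x)) =
      algebraMap ℂ _ (Coalgebra.counit x) := by
  induction x using induction with
  | hs z =>
    have h1 : antipodeLin q 1 = 1 := by simpa using antipodeLin_algebraMap (q := q) 1
    simp [Algebra.TensorProduct.algebraMap_apply, h1]
  | hg g =>
    have hq := q_ne_zero (q := q)
    cases g <;>
    · simp only [comul_gen, counit_gen, comulGen, counitGen, map_add, LinearMap.lTensor_tmul,
        LinearMap.mul'_apply, antipodeLin_gen, antipodeGen, MulOpposite.unop_op, mul_smul_comm,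
        rel_ab, rel_ac, ← rel_bc, rel_bd, rel_cd, da_eq, ad_eq, map_one, map_zero]
      match_scalars <;> field_simp <;> ring
  | hm x y hx hy =>
    rw [Bialgebra.comul_mul, Bialgebra.counit_mul, map_mul (algebraMap _ _), ← hx]
    generalize Coalgebra.comul (R := ℂ) x = t
    induction t with
    | zero => simp
    | tmul u v =>
      rw [mul_antipode_right_aux, hy, mul_assoc, Algebra.commutes, ← mul_assoc]
      simp
    | add u v hu hv => simp only [add_mul, map_add, hu, hv]
  | ha x y hx hy => simp [hx, hy]

instance : HopfAlgebra ℂ (SLq q) where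
  antipode := antipodeLin q
  mul_antipode_rTensor_comul := LinearMap.ext mul_antipode_left
  mul_antipode_lTensor_comul := LinearMap.ext mul_antipode_right

/-- The conjugate-linear ring homomorphism on the free algebra sending each generator to its
(opposite) image in `SL_q(2)`. -/
def starFree (q : Circle) : FreeAlgebra ℂ Gen →+* (SLq q)ᵐᵒᵖ :=
  (MonoidAlgebra.liftNCRingHom ((algebraMap ℂ (SLq q)ᵐᵒᵖ).comp (starRingEnd ℂ))
    (FreeMonoid.lift fun g => MulOpposite.op (gen q g))
    (fun z _ => Algebra.commutes (conj z) _)).comp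
    (FreeAlgebra.equivMonoidAlgebraFreeMonoid (R := ℂ) (X := Gen)).toRingEquiv.toRingHom

theorem starFree_gen (g : Gen) : starFree q (fr g) = MulOpposite.op (gen q g) := by
  simp only [starFree, fr, FreeAlgebra.equivMonoidAlgebraFreeMonoid, RingHom.comp_apply]
  erw [FreeAlgebra.lift_ι_apply]
  simp [MonoidAlgebra.liftNCRingHom, MonoidAlgebra.liftNC_single]

theorem starFree_algebraMap (z : ℂ) :
    starFree q (algebraMap ℂ _ z) = algebraMap ℂ _ (conj z) := by
  simp [starFree, MonoidAlgebra.liftNCRingHom, MonoidAlgebra.liftNC_single]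

theorem starFree_smul (z : ℂ) (x : FreeAlgebra ℂ Gen) :
    starFree q (z • x) = conj z • starFree q x := by
  rw [Algebra.smul_def, map_mul, starFree_algebraMap, Algebra.smul_def]

/-- The involution as a conjugate-linear anti-homomorphism fixing the generators. -/
def starHom (q : Circle) : SLq q →+* (SLq q)ᵐᵒᵖ :=
  RingQuot.lift ⟨starFree q, by
    have hq := q_ne_zero (q := q)
    intro x y h
    apply MulOpposite.unop_injective
    cases h <;>
    · simp only [map_mul, map_sub, map_one, starFree_smul, starFree_gen, MulOpposite.unop_mul,
        MulOpposite.unop_smul, MulOpposite.unop_op, map_inv₀, ← Circle.coe_inv_eq_conj,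
        Circle.coe_inv, MulOpposite.unop_sub, MulOpposite.unop_one, rel_ab, rel_ac,
        ← rel_bc, rel_bd, rel_cd, da_eq, ad_eq, smul_smul]
      try (match_scalars <;> field_simp <;> ring)⟩

theorem starHom_mk (x : FreeAlgebra ℂ Gen) : starHom q (mk q x) = starFree q x := by
  have : mk q x = RingQuot.mkRingHom (Rel q) x := by
    rw [← RingQuot.mkAlgHom_coe ℂ]; rfl
  rw [this]
  exact RingQuot.lift_mkRingHom_apply ..

theorem starHom_gen (g : Gen) : starHom q (gen q g) = MulOpposite.op (gen q g) :=
  (starHom_mk _).trans (starFree_gen g)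

theorem starHom_algebraMap (z : ℂ) :
    starHom q (algebraMap ℂ _ z) = algebraMap ℂ _ (conj z) := by
  rw [← AlgHom.commutes (mk q), starHom_mk, starFree_algebraMap]

/-- The involution of `SL_q(2, ℝ)`: conjugate linear, anti-multiplicative, with
`a, b, c, d` self-adjoint. -/
instance : StarRing (SLq q) where
  star x := (starHom q x).unop
  star_involutive x := by
    induction x using induction with
    | hs z => simp [starHom_algebraMap]
    | hg g => simp [starHom_gen]
    | hm x y hx hy => simp [hx, hy]
    | ha x y hx hy => simp [hx, hy]
  star_mul x y := by simp
  star_add x y := by simp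

theorem star_def (x : SLq q) : star x = (starHom q x).unop := rfl

@[simp] theorem star_gen (g : Gen) : star (gen q g) = gen q g := by
  simp [star_def, starHom_gen]

instance : StarModule ℂ (SLq q) where
  star_smul z x := by
    rw [Algebra.smul_def, star_mul, star_def (algebraMap _ _ _), starHom_algebraMap,
      Algebra.smul_def]
    simp [Algebra.commutes]

variable (q) in
/-- The conjugate-linear map `τ = * ∘ S`. -/
def tau : SLq q →ₛₗ[starRingEnd ℂ] SLq q where
  toFun x := star (HopfAlgebra.antipode ℂ x)
  map_add' x y := by simp
  map_smul' z x := by simp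

theorem tau_mul (x y : SLq q) : tau q (x * y) = tau q x * tau q y := by
  change star (antipodeLin q (x * y)) = star (antipodeLin q x) * star (antipodeLin q y)
  rw [antipodeLin_mul, star_mul]

theorem tau_gen (g : Gen) : tau q (gen q g) = star (antipodeGen q g).unop :=
  congrArg star (antipodeLin_gen g)

end SLq

/-! ### The coisotropic subgroups `K_{μν}`

`s` is a chosen square root `q^{1/2}` of `q = s ^ 2`. -/

open SLq

/-- The element `a - d + 2 q^{1/2} μ b`. -/
def coisoGen₁ (s : Circle) (μ : ℝ) : SLq (s ^ 2) :=
  gen _ a - gen _ d + (2 * (s : ℂ) * (μ : ℂ)) • gen _ b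

/-- The element `q ν b + c`. -/
def coisoGen₂ (s : Circle) (ν : ℝ) : SLq (s ^ 2) :=
  (((s ^ 2 : Circle) : ℂ) * (ν : ℂ)) • gen _ b + gen _ c

/-- The coideal `C_{μν}`. -/
def coisoSpan (s : Circle) (μ ν : ℝ) : Submodule ℂ (SLq (s ^ 2)) :=
  Submodule.span ℂ {coisoGen₁ s μ, coisoGen₂ s ν}

/-- The right ideal `R_{μν} = C_{μν} · SL_q(2, ℝ)`. -/
def coisoIdeal (s : Circle) (μ ν : ℝ) : Submodule ℂ (SLq (s ^ 2)) :=
  coisoSpan s μ ν * ⊤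

theorem coisoGen₁_mul_mem (s : Circle) (μ ν : ℝ) (x : SLq (s ^ 2)) :
    coisoGen₁ s μ * x ∈ coisoIdeal s μ ν :=
  Submodule.mul_mem_mul (Submodule.subset_span (by simp)) trivial

theorem coisoGen₂_mul_mem (s : Circle) (μ ν : ℝ) (x : SLq (s ^ 2)) :
    coisoGen₂ s ν * x ∈ coisoIdeal s μ ν :=
  Submodule.mul_mem_mul (Submodule.subset_span (by simp)) trivial

/-- To check inclusion of the right ideal it is enough to check multiples of its generators. -/
theorem coisoIdeal_le {s : Circle} {μ ν : ℝ} {N : Submodule ℂ (SLq (s ^ 2))}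
    (h₁ : ∀ x, coisoGen₁ s μ * x ∈ N) (h₂ : ∀ x, coisoGen₂ s ν * x ∈ N) :
    coisoIdeal s μ ν ≤ N := by
  refine Submodule.mul_le.mpr fun m hm x _ => ?_
  induction hm using Submodule.span_induction with
  | mem m hm => rcases hm with rfl | rfl <;> simp [h₁, h₂]
  | zero => simp
  | add m m' _ _ hm hm' => rw [add_mul]; exact N.add_mem hm hm'
  | smul z m _ hm => rw [smul_mul_assoc]; exact N.smul_mem z hm

theorem comul_coisoGen₁ (s : Circle) (μ ν : ℝ) :
    Coalgebra.comul (R := ℂ) (coisoGen₁ s μ) =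
      coisoGen₁ s μ ⊗ₜ (gen _ a + (2 * (s : ℂ) * (μ : ℂ)) • gen _ b) +
      (gen _ d - (2 * (s : ℂ) * (μ : ℂ)) • gen _ b) ⊗ₜ coisoGen₁ s μ +
      gen _ b ⊗ₜ coisoGen₂ s ν - coisoGen₂ s ν ⊗ₜ gen _ b := by
  simp only [coisoGen₁, coisoGen₂, map_add, map_sub, map_smul, comul_gen, comulGen,
    TensorProduct.add_tmul, TensorProduct.tmul_add, TensorProduct.sub_tmul,
    TensorProduct.tmul_sub, ← TensorProduct.smul_tmul', TensorProduct.tmul_smul]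
  module

theorem comul_coisoGen₂ (s : Circle) (μ ν : ℝ) :
    Coalgebra.comul (R := ℂ) (coisoGen₂ s ν) =
      (gen _ a + (2 * (s : ℂ) * (μ : ℂ)) • gen _ b) ⊗ₜ coisoGen₂ s ν +
      coisoGen₂ s ν ⊗ₜ (gen _ d - (2 * (s : ℂ) * (μ : ℂ)) • gen _ b) -
      coisoGen₁ s μ ⊗ₜ gen _ c + gen _ c ⊗ₜ coisoGen₁ s μ := by
  simp only [coisoGen₁, coisoGen₂, map_add, map_sub, map_smul, comul_gen, comulGen,
    TensorProduct.add_tmul, TensorProduct.tmul_add, TensorProduct.sub_tmul,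
    TensorProduct.tmul_sub, ← TensorProduct.smul_tmul', TensorProduct.tmul_smul]
  module

/-- The right ideal `R_{μν}` is a two-sided coideal. -/
instance (s : Circle) (μ ν : ℝ) : (coisoIdeal s μ ν).IsCoideal where
  counit_eq_zero := by
    refine coisoIdeal_le (N := LinearMap.ker (Coalgebra.counit (R := ℂ))) ?_ ?_ <;> intro x
    · simp [coisoGen₁, counitGen]
    · simp [coisoGen₂, counitGen]
  map_mkQ_comul_eq_zero := by
    have k₁ : ∀ x, (coisoIdeal s μ ν).mkQ (coisoGen₁ s μ * x) = 0 := fun x =>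
      (Submodule.Quotient.mk_eq_zero _).mpr (coisoGen₁_mul_mem s μ ν x)
    have k₂ : ∀ x, (coisoIdeal s μ ν).mkQ (coisoGen₂ s ν * x) = 0 := fun x =>
      (Submodule.Quotient.mk_eq_zero _).mpr (coisoGen₂_mul_mem s μ ν x)
    refine coisoIdeal_le (N := LinearMap.ker ((TensorProduct.map (coisoIdeal s μ ν).mkQ
      (coisoIdeal s μ ν).mkQ) ∘ₗ Coalgebra.comul)) ?_ ?_ <;> intro x
    · rw [LinearMap.mem_ker, LinearMap.comp_apply, Bialgebra.comul_mul, comul_coisoGen₁ s μ ν]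
      generalize Coalgebra.comul (R := ℂ) x = t
      induction t with
      | zero => simp
      | tmul u v =>
        simp only [add_mul, sub_mul, Algebra.TensorProduct.tmul_mul_tmul, map_add, map_sub,
          TensorProduct.map_tmul, k₁, k₂, TensorProduct.tmul_zero, TensorProduct.zero_tmul]
        simp
      | add u v hu hv => rw [mul_add, map_add, hu, hv, add_zero]
    · rw [LinearMap.mem_ker, LinearMap.comp_apply, Bialgebra.comul_mul, comul_coisoGen₂ s μ ν]
      generalize Coalgebra.comul (R := ℂ) x = t
      induction t with
      | zero => simp
      | tmul u v =>
        simp only [add_mul, sub_mul, Algebra.TensorProduct.tmul_mul_tmul, map_add, map_sub,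
          TensorProduct.map_tmul, k₁, k₂, TensorProduct.tmul_zero, TensorProduct.zero_tmul]
        simp
      | add u v hu hv => rw [mul_add, map_add, hu, hv, add_zero]

/-- The coalgebra `K_{μν} = SL_q(2, ℝ) / R_{μν}`, with the quotient coalgebra structure. -/
abbrev K (s : Circle) (μ ν : ℝ) : Type := SLq (s ^ 2) ⧸ coisoIdeal s μ ν

/-- The quotient map `r_{μν}`. -/
abbrev r (s : Circle) (μ ν : ℝ) : SLq (s ^ 2) →ₗ[ℂ] K s μ ν := (coisoIdeal s μ ν).mkQ

theorem tau_coisoGen₁ (s : Circle) (μ : ℝ) :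
    tau _ (coisoGen₁ s μ) = - coisoGen₁ s μ := by
  have hs := q_ne_zero (q := s)
  simp only [coisoGen₁, map_add, map_sub, map_smulₛₗ, tau_gen, antipodeGen, MulOpposite.unop_op,
    star_gen, star_smul, RCLike.star_def, map_mul, map_neg, map_pow, map_inv₀, ← Circle.coe_inv_eq_conj,
    Circle.coe_inv, Circle.coe_pow, Complex.conj_ofReal, map_ofNat]
  match_scalars <;> field_simp

theorem tau_coisoGen₂ (s : Circle) (ν : ℝ) :
    tau _ (coisoGen₂ s ν) = (-((s ^ 2 : Circle) : ℂ)⁻¹) • coisoGen₂ s ν := by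
  have hs := q_ne_zero (q := s)
  simp only [coisoGen₂, map_add, map_sub, map_smulₛₗ, tau_gen, antipodeGen, MulOpposite.unop_op,
    star_gen, star_smul, RCLike.star_def, map_mul, map_neg, map_pow, map_inv₀, ← Circle.coe_inv_eq_conj,
    Circle.coe_inv, Circle.coe_pow, Complex.conj_ofReal, map_ofNat]
  match_scalars <;> field_simp

theorem tau_coisoIdeal (s : Circle) (μ ν : ℝ) :
    coisoIdeal s μ ν ≤ (coisoIdeal s μ ν).comap (tau (s ^ 2)) := by
  refine coisoIdeal_le ?_ ?_ <;> intro x <;> rw [Submodule.mem_comap, tau_mul]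
  · rw [tau_coisoGen₁, neg_mul]
    exact neg_mem (coisoGen₁_mul_mem s μ ν _)
  · rw [tau_coisoGen₂, smul_mul_assoc]
    exact Submodule.smul_mem _ _ (coisoGen₂_mul_mem s μ ν _)

/-- The conjugate-linear map `τ` induced on `K_{μν}`, so that `τ ∘ r = r ∘ τ`. -/
def tauK (s : Circle) (μ ν : ℝ) : K s μ ν →ₛₗ[starRingEnd ℂ] K s μ ν :=
  Submodule.mapQ _ _ (tau (s ^ 2)) (tau_coisoIdeal s μ ν)

/-! ### The coalgebra `R_q` of the special series `μ² = ν` -/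

/-- The coalgebra `R_q = K_{μν}` with `ν = μ²`. -/
abbrev Rq (s : Circle) (μ : ℝ) : Type := K s μ (μ ^ 2)

/-- The `q`-number `[n]_q`. -/
def qNum (q : ℂ) (n : ℕ) : ℂ := (q ^ n - (q ^ n)⁻¹) / (q - q⁻¹)

/-- The `q`-factorial `[n]_q!`. -/
def qFact (q : ℂ) (n : ℕ) : ℂ := ∏ i ∈ Finset.range n, qNum q (i + 1)

/-- `w_n = (a + q^{1/2} μ b) (a + q^{3/2} μ b) ⋯ (a + q^{n-1/2} μ b)`. -/
def w (s : Circle) (μ : ℝ) : ℕ → SLq (s ^ 2)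
  | 0 => 1
  | n + 1 => w s μ n * (gen _ a + ((s : ℂ) ^ (2 * n + 1) * (μ : ℂ)) • gen _ b)

/-- `v_n = r[w_n]`. -/
def v (s : Circle) (μ : ℝ) (n : ℕ) : Rq s μ := r s μ (μ ^ 2) (w s μ n)

/-- `X_n = ∑_{i=1}^n (q - q⁻¹)^{i-1} q^{i/2} μ^i [n-1]_q! / ([i]_q [n-i]_q!) v_{n-i} · b^i`,
for `n ≥ 1`; the right action on the quotient is `r[x] · y = r[x y]`. -/
def X (s : Circle) (μ : ℝ) (n : ℕ) : Rq s μ :=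
  ∑ i ∈ Finset.Icc 1 n,
    (((s : ℂ) ^ 2 - ((s : ℂ) ^ 2)⁻¹) ^ (i - 1) * (s : ℂ) ^ i * (μ : ℂ) ^ i *
        qFact ((s : ℂ) ^ 2) (n - 1) /
      (qNum ((s : ℂ) ^ 2) i * qFact ((s : ℂ) ^ 2) (n - i))) •
      r s μ (μ ^ 2) (w s μ (n - i) * gen _ b ^ i)

/-- The subspaces `R_q^{(0)} = Span {v_0}` and `R_q^{(n)} = Span {v_n, X_n}` for `n > 0`. -/
def component (s : Circle) (μ : ℝ) (n : ℕ) : Submodule ℂ (Rq s μ) :=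
  if n = 0 then Submodule.span ℂ {v s μ 0} else Submodule.span ℂ {v s μ n, X s μ n}

end QuantumSL2

/-! ### Subcoalgebras and corepresentations -/

section Coalg

variable {C : Type*} [AddCommGroup C] [Module ℂ C] [Coalgebra ℂ C]

/-- `D` is a subcoalgebra: `Δ D ⊆ D ⊗ D`. -/
def IsSubcoalgebra (D : Submodule ℂ C) : Prop :=
  ∀ x ∈ D, Coalgebra.comul (R := ℂ) x ∈ LinearMap.range (TensorProduct.map D.subtype D.subtype)

/-- `D` is a cocommutative subcoalgebra. -/
def IsCocommSubcoalgebra (D : Submodule ℂ C) : Prop :=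
  IsSubcoalgebra D ∧
    ∀ x ∈ D, TensorProduct.comm ℂ C C (Coalgebra.comul x) = Coalgebra.comul (R := ℂ) x

/-- `D` is a simple subcoalgebra: nonzero, with no subcoalgebras other than `0` and `D`. -/
def IsSimpleSubcoalgebra (D : Submodule ℂ C) : Prop :=
  IsSubcoalgebra D ∧ D ≠ ⊥ ∧ ∀ E : Submodule ℂ C, IsSubcoalgebra E → E ≤ D → E = ⊥ ∨ E = D

variable (C) in
/-- A coalgebra is pointed if all its simple subcoalgebras are one dimensional. -/
def IsPointedCoalgebra : Prop :=
  ∀ D : Submodule ℂ C, IsSimpleSubcoalgebra D → Module.finrank ℂ D = 1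

/-- A (right) corepresentation of `C` on `V`. -/
structure IsCorepresentation {V : Type*} [AddCommGroup V] [Module ℂ V]
    (ρ : V →ₗ[ℂ] V ⊗[ℂ] C) : Prop where
  coassoc : ∀ x, TensorProduct.assoc ℂ V C C (ρ.rTensor C (ρ x)) =
    (Coalgebra.comul (R := ℂ) (A := C)).lTensor V (ρ x)
  counit : ∀ x, TensorProduct.rid ℂ V ((Coalgebra.counit (R := ℂ) (A := C)).lTensor V (ρ x)) = x

/-- The matrix coefficient `⟨y, x₍₀₎⟩ x₍₁₎`, where `ρ x = x₍₀₎ ⊗ x₍₁₎`. -/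
def matrixCoeff {V : Type*} [NormedAddCommGroup V] [InnerProductSpace ℂ V]
    (ρ : V →ₗ[ℂ] V ⊗[ℂ] C) (y x : V) : C :=
  TensorProduct.lid ℂ C ((innerₛₗ ℂ y).rTensor C (ρ x))

/-- A corepresentation on an inner product space is unitary with respect to the real structure
`τ` if `τ(ρ_{ij}) = ρ_{ji}` for its matrix coefficients; when `τ = * ∘ S` comes from an involution
this is the usual condition `S(ρ_{ij}) = (ρ_{ji})^*`. -/
structure IsUnitaryCorepresentation (τ : C →ₛₗ[starRingEnd ℂ] C) {V : Type*}
    [NormedAddCommGroup V] [InnerProductSpace ℂ V] (ρ : V →ₗ[ℂ] V ⊗[ℂ] C) : Prop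
    extends IsCorepresentation ρ where
  unitary : ∀ x y, τ (matrixCoeff ρ x y) = matrixCoeff ρ y x

/-- The linear map `ℂ → ℂ ⊗ C`, `z ↦ z ⊗ g`; for `g` group-like it is the one-dimensional
corepresentation attached to `g`. -/
def oneDimCorep (g : C) : ℂ →ₗ[ℂ] ℂ ⊗[ℂ] C := (TensorProduct.mk ℂ ℂ C).flip g

end Coalg

end

/-! Write `q = s ^ 2` and `t_n = q^{n+1/2} μ`. The elements `v_n` are group-like because, when `ν =
μ²`, the coideal relations give `v_n · (c + t_n d) = t_n v_{n+1}` (`r_w_mul_cd`). Since `Δ(a + t b)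
= a ⊗ (a + t b) + b ⊗ (c + t d)`, group-likeness passes from `v_n` to `v_{n+1}`.

Everything else is spectral theory of one operator. There is a functional `Y` on `SL_q(2)`, a
derivation twisted by the character `χ`, that vanishes on the coideal and so descends to `R_q`. Let
`D = opK` be `x ↦ x₍₁₎ Y(x₍₂₎)`. It preserves every subcoalgebra and satisfies `Δ ∘ D = (id ⊗ D) ∘
Δ`. Group-likes are eigenvectors: `D v_n = λ_n v_n` with `λ_n` an affine function of `q^n + q^{-n}`,
so the `λ_n` are distinct when `q` is not a root of unity. The sum defining `X_n` is arranged to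
telescope under `D`, with `(D - λ_n) X_n` a nonzero multiple of `v_n` (`opK_X`). Hence the
components lie in distinct generalized eigenspaces and are independent. They exhaust `R_q` by a
dimension count on the spans of the `v_k · b^i` with `k + i = n` (`homSpan_eq`).

Consequently the eigenvectors of `D` are exactly the nonzero multiples of the `v_n`. As `D` is
locally finite, each nonzero subcoalgebra contains some `v_n`, which determines the simple ones. The
formula `Δ X_n = v_n ⊗ X_n + X_n ⊗ v_n` follows because `D - λ_n` and the counit are jointly
injective (`comul_X`). Finally, `v_1` carries a nonzero primitive element and `v_0` carries none,
whereas in a Hopf algebra translation by group-likes makes all group-likes look alike. -/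

noncomputable section

/-! ### The group-like elements `v_n` and their invariance under `τ` -/

namespace QuantumSL2

open Gen SLq

variable (s : Circle) (μ : ℝ)

theorem w_succ (n : ℕ) : w s μ (n + 1) =
    w s μ n * (gen _ a + ((s : ℂ) ^ (2 * n + 1) * (μ : ℂ)) • gen _ b) := rfl

/-- Right multiplication by `z` on the quotient `R_q`. -/
def act (z : SLq (s ^ 2)) : Rq s μ →ₗ[ℂ] Rq s μ :=
  Submodule.mapQ _ _ (LinearMap.mulRight ℂ z) (coisoIdeal_le
    (fun x => by
      rw [Submodule.mem_comap, LinearMap.mulRight_apply, mul_assoc]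
      exact coisoGen₁_mul_mem s μ _ _)
    (fun x => by
      rw [Submodule.mem_comap, LinearMap.mulRight_apply, mul_assoc]
      exact coisoGen₂_mul_mem s μ _ _))

theorem act_r (z x : SLq (s ^ 2)) : act s μ z (r s μ (μ ^ 2) x) = r s μ (μ ^ 2) (x * z) := rfl

theorem r_coisoGen₂_mul (x : SLq (s ^ 2)) :
    r s μ (μ ^ 2) (coisoGen₂ s (μ ^ 2) * x) = 0 :=
  (Submodule.Quotient.mk_eq_zero _).mpr (coisoGen₂_mul_mem s μ (μ ^ 2) x)

variable {s} in
-- Exchange rule that moves `c + t d` leftwards through the factors of `w_n`, lowering its parameter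
-- by a factor `q` at each step.
theorem gen_linear_mul_gen_linear (t : ℂ) :
    (gen (s ^ 2) a + t • gen _ b) * (gen _ c + ((s : ℂ) ^ 2 * t) • gen _ d) =
      (s : ℂ) ^ 2 • ((gen _ c + t • gen _ d) * (gen _ a + ((s : ℂ) ^ 2 * t) • gen _ b)) := by
  have hs := q_ne_zero (q := s)
  simp only [mul_add, add_mul, smul_mul_assoc, mul_smul_comm, rel_ab, rel_ac,
      ← rel_bc, rel_bd, rel_cd, da_eq, ad_eq, smul_add, smul_smul, Circle.coe_pow]
  match_scalars <;> field_simp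

variable {s} in
-- The coideal generator `q μ² b + c` can be pushed left through every factor of `w_n`; once
-- leftmost it is killed by `r`. Thus it annihilates each `v_n`, not just `v_0`.
theorem gen_linear_mul_coisoGen₂ (t : ℂ) :
    (gen (s ^ 2) a + t • gen _ b) * coisoGen₂ s (μ ^ 2) =
      coisoGen₂ s (μ ^ 2) * ((s : ℂ) ^ 2 • gen _ a + t • gen _ b) := by
  simp only [coisoGen₂, mul_add, add_mul, smul_mul_assoc, mul_smul_comm, rel_ab, rel_ac,
      ← rel_bc, smul_add, smul_smul, Circle.coe_pow]
  match_scalars <;> ring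

theorem r_w_mul_coisoGen₂ (n : ℕ) (x : SLq (s ^ 2)) :
    r s μ (μ ^ 2) (w s μ n * (coisoGen₂ s (μ ^ 2) * x)) = 0 := by
  induction n generalizing x with
  | zero => rw [w, one_mul, r_coisoGen₂_mul]
  | succ n ih =>
    rw [w_succ, mul_assoc, ← mul_assoc _ _ x, gen_linear_mul_coisoGen₂, mul_assoc, ih]

/-- `v_n · c = - q μ² v_n · b`. -/
theorem r_w_mul_c (n : ℕ) : r s μ (μ ^ 2) (w s μ n * gen _ c) =
    (-((s : ℂ) ^ 2 * (μ : ℂ) ^ 2)) • r s μ (μ ^ 2) (w s μ n * gen _ b) := by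
  have h := r_w_mul_coisoGen₂ s μ n 1
  simp only [coisoGen₂, mul_one, mul_add, mul_smul_comm, map_add, map_smul, Circle.coe_pow,
    Complex.ofReal_pow] at h
  rw [neg_smul]
  exact eq_neg_of_add_eq_zero_right h

/-- The exchange rule reduces the claim to `n = 0`, which is a congruence modulo the coideal and the
place where `ν = μ²` enters. The spectator `x` is needed because the inductive step leaves a factor
on the right. -/
theorem r_w_mul_cd (n : ℕ) (x : SLq (s ^ 2)) :
    r s μ (μ ^ 2) (w s μ n *
        ((gen _ c + ((s : ℂ) ^ (2 * n + 1) * (μ : ℂ)) • gen _ d) * x)) =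
      ((s : ℂ) ^ (2 * n + 1) * (μ : ℂ)) • r s μ (μ ^ 2) (w s μ (n + 1) * x) := by
  induction n generalizing x with
  | zero =>
    have h : (gen (s ^ 2) c + ((s : ℂ) * (μ : ℂ)) • gen _ d) =
        ((s : ℂ) * (μ : ℂ)) • (gen _ a + ((s : ℂ) * (μ : ℂ)) • gen _ b)
        + coisoGen₂ s (μ ^ 2) - ((s : ℂ) * (μ : ℂ)) • coisoGen₁ s μ := by
      simp only [coisoGen₁, coisoGen₂, Circle.coe_pow, Complex.ofReal_pow]
      module
    have h1 : r s μ (μ ^ 2) (coisoGen₁ s μ * x) = 0 :=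
      (Submodule.Quotient.mk_eq_zero _).mpr (coisoGen₁_mul_mem s μ (μ ^ 2) x)
    simp only [mul_zero, zero_add, pow_one, w, one_mul]
    rw [h]
    simp only [add_mul, sub_mul, map_add, map_sub, r_coisoGen₂_mul, smul_mul_assoc, map_smul, h1]
    simp
  | succ n ih =>
    have e : (s : ℂ) ^ (2 * (n + 1) + 1) * (μ : ℂ)
        = (s : ℂ) ^ 2 * ((s : ℂ) ^ (2 * n + 1) * (μ : ℂ)) := by ring
    rw [w_succ _ _ (n + 1), e]
    rw [w_succ, mul_assoc, ← mul_assoc _ _ x, gen_linear_mul_gen_linear, smul_mul_assoc,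
      mul_smul_comm, map_smul, mul_assoc (gen _ c + _), ih, smul_smul, w_succ]
    simp only [mul_assoc]

/-- `v_n · d = v_n · a + (q^{n+1/2} + q^{1/2-n}) μ v_n · b`. -/
theorem r_w_mul_d (hμ : μ ≠ 0) (n : ℕ) : r s μ (μ ^ 2) (w s μ n * gen _ d) =
    r s μ (μ ^ 2) (w s μ (n + 1)) +
      ((s : ℂ) * (μ : ℂ) * ((s : ℂ) ^ (2 * n))⁻¹) • r s μ (μ ^ 2) (w s μ n * gen _ b) := by
  have hs := q_ne_zero (q := s)
  have hμ' : (μ : ℂ) ≠ 0 := by exact_mod_cast hμ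
  have h := r_w_mul_cd s μ n 1
  simp only [mul_one, mul_add, map_add, mul_smul_comm, map_smul, r_w_mul_c] at h
  have ht : (s : ℂ) ^ (2 * n + 1) * (μ : ℂ) ≠ 0 := mul_ne_zero (pow_ne_zero _ hs) hμ'
  apply smul_right_injective _ ht
  simp only [smul_add, smul_smul]
  rw [← h]
  match_scalars <;> field_simp
  ring

/-- With `t = t_n`, the coproduct of `v_n · (a + t b)` is `v_n · a ⊗ v_{n+1} + v_n · b ⊗ v_n · (c +
t d)`. By `r_w_mul_cd` the second right leg is `t v_{n+1}`, so the left legs recombine to `v_{n+1}`.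
-/
theorem isGroupLikeElem_v (n : ℕ) : IsGroupLikeElem ℂ (v s μ n) := by
  have counit : ∀ n, Coalgebra.counit (R := ℂ) (w s μ n) = 1 := by
    intro n
    induction n with
    | zero => simp [w]
    | succ n ih => simp [w_succ, ih, counitGen]
  refine ⟨counit n, ?_⟩
  induction n with
  | zero =>
    change TensorProduct.map _ _ (Coalgebra.comul (R := ℂ) (1 : SLq (s ^ 2))) = _
    rw [Bialgebra.comul_one]
    rfl
  | succ n ih =>
    have key : ∀ x y : SLq (s ^ 2), ∀ t : SLq (s ^ 2) ⊗[ℂ] SLq (s ^ 2),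
        TensorProduct.map (r s μ (μ ^ 2)) (r s μ (μ ^ 2)) (t * x ⊗ₜ y) =
        TensorProduct.map (act s μ x) (act s μ y)
          (TensorProduct.map (r s μ (μ ^ 2)) (r s μ (μ ^ 2)) t) := by
      intro x y t
      induction t with
      | zero => simp
      | tmul u v => simp only [Algebra.TensorProduct.tmul_mul_tmul, TensorProduct.map_tmul, act_r]
      | add u v hu hv => simp only [add_mul, map_add, hu, hv]
    have ih' : TensorProduct.map (r s μ (μ ^ 2)) (r s μ (μ ^ 2))
        (Coalgebra.comul (R := ℂ) (w s μ n)) = v s μ n ⊗ₜ v s μ n := ih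
    have h := r_w_mul_cd s μ n 1
    simp only [mul_one] at h
    set t : ℂ := (s : ℂ) ^ (2 * n + 1) * (μ : ℂ) with ht
    have hc : Coalgebra.comul (R := ℂ) (gen (s ^ 2) a + t • gen _ b) =
        gen _ a ⊗ₜ (gen _ a + t • gen _ b) + gen _ b ⊗ₜ (gen _ c + t • gen _ d) := by
      simp only [map_add, map_smul, comul_gen, comulGen, TensorProduct.tmul_add,
        TensorProduct.tmul_smul, smul_add]
      abel
    change TensorProduct.map (r s μ (μ ^ 2)) (r s μ (μ ^ 2))
      (Coalgebra.comul (R := ℂ) (w s μ n * (gen (s ^ 2) a + t • gen _ b))) = _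
    rw [Bialgebra.comul_mul, hc, mul_add, map_add, key, key, ih', TensorProduct.map_tmul,
      TensorProduct.map_tmul]
    simp only [v, act_r] at *
    rw [h, ← w_succ, TensorProduct.tmul_smul, TensorProduct.smul_tmul', ← TensorProduct.add_tmul,
      ← map_smul, ← map_add, ← mul_smul_comm, ← mul_add, ← w_succ]

theorem tauK_v (hμ : μ ≠ 0) (n : ℕ) : tauK s μ (μ ^ 2) (v s μ n) = v s μ n := by
  have hs := q_ne_zero (q := s)
  change r s μ (μ ^ 2) (tau _ (w s μ n)) = r s μ (μ ^ 2) (w s μ n)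
  induction n with
  | zero =>
    have : tau (s ^ 2) 1 = 1 := by
      change star (antipodeLin (s ^ 2) 1) = 1
      have h1 : antipodeLin (s ^ 2) 1 = 1 := by simpa using antipodeLin_algebraMap (q := s ^ 2) 1
      rw [h1, star_one]
    rw [w, this]
  | succ n ih =>
    -- `τ` is multiplicative, so it acts factor by factor; the `b` term produced here is exactly the
    -- one by which `v_n · d` differs from `v_{n+1}` in `r_w_mul_d`.
    have h : tau (s ^ 2) (gen _ a + ((s : ℂ) ^ (2 * n + 1) * (μ : ℂ)) • gen _ b) =
        gen _ d - ((s : ℂ) * (μ : ℂ) * ((s : ℂ) ^ (2 * n))⁻¹) • gen _ b := by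
      simp only [map_add, map_sub, map_smulₛₗ, tau_gen, antipodeGen, MulOpposite.unop_op,
        star_gen, star_smul, RCLike.star_def, map_mul, map_neg, map_pow, map_inv₀, inv_pow,
        ← Circle.coe_inv_eq_conj, Circle.coe_inv, Circle.coe_pow, Complex.conj_ofReal, map_ofNat]
      match_scalars <;> field_simp
      ring
    rw [w_succ, tau_mul, h, ← act_r, ih, act_r, mul_sub, map_sub, r_w_mul_d s μ hμ,
      mul_smul_comm, map_smul, add_sub_cancel_right, w_succ]

end QuantumSL2

/-! ### Functionals acting on a coalgebra -/

section Coalg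

variable {C : Type*} [AddCommGroup C] [Module ℂ C] [Coalgebra ℂ C]

/-- The left action `x ↦ x₍₁₎ f(x₍₂₎)` of a functional `f` on a coalgebra. -/
def hit (f : C →ₗ[ℂ] ℂ) : C →ₗ[ℂ] C :=
  (TensorProduct.rid ℂ C).toLinearMap ∘ₗ f.lTensor C ∘ₗ Coalgebra.comul

theorem hit_apply (f : C →ₗ[ℂ] ℂ) (x : C) :
    hit f x = TensorProduct.rid ℂ C (f.lTensor C (Coalgebra.comul x)) := rfl

/-- Coassociativity: the functional only touches the last tensor leg. This is what lets the operator
be applied to an unknown coproduct. -/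
theorem comul_hit (f : C →ₗ[ℂ] ℂ) (x : C) :
    Coalgebra.comul (R := ℂ) (hit f x) = (hit f).lTensor C (Coalgebra.comul x) := by
  have h1 : ∀ t : C ⊗[ℂ] C, Coalgebra.comul (R := ℂ) (TensorProduct.rid ℂ C (f.lTensor C t)) =
      ((TensorProduct.rid ℂ C).toLinearMap ∘ₗ f.lTensor C).lTensor C
        (TensorProduct.assoc ℂ C C C ((Coalgebra.comul (R := ℂ)).rTensor C t)) := by
    intro t
    induction t with
    | zero => simp
    | add u v hu hv => simp only [map_add, hu, hv]
    | tmul x y =>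
      simp only [LinearMap.lTensor_tmul, TensorProduct.rid_tmul, map_smul, LinearMap.rTensor_tmul]
      generalize Coalgebra.comul (R := ℂ) x = u
      induction u with
      | zero => simp
      | add u v hu hv => simp only [smul_add, TensorProduct.add_tmul, map_add, hu, hv]
      | tmul x z => simp
  rw [hit_apply, h1, Coalgebra.coassoc_apply, hit, ← LinearMap.comp_assoc,
    LinearMap.lTensor_comp _ _ Coalgebra.comul]
  rfl

/-- A subcoalgebra is stable under the action of functionals. -/
theorem IsSubcoalgebra.hit_mem {D : Submodule ℂ C} (hD : IsSubcoalgebra D) (f : C →ₗ[ℂ] ℂ)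
    {x : C} (hx : x ∈ D) : hit f x ∈ D := by
  obtain ⟨t, ht⟩ := hD x hx
  rw [hit_apply, ← ht]
  clear ht
  induction t with
  | zero => simp
  | add u v hu hv => simp only [map_add]; exact D.add_mem hu hv
  | tmul y z => simpa using D.smul_mem _ y.2

theorem IsGroupLikeElem.hit_eq {g : C} (hg : IsGroupLikeElem ℂ g) (f : C →ₗ[ℂ] ℂ) :
    hit f g = f g • g := by
  simp [hit_apply, hg.comul_eq_tmul_self]

end Coalg

/-! ### The twisted derivation `Y` and its operator on `R_q` -/

namespace QuantumSL2

open Gen SLq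

/-- The character `a ↦ q⁻¹, d ↦ q, b, c ↦ 0` of `SL_q(2)`. -/
def charHom (q : Circle) : SLq q →ₐ[ℂ] ℂ := by
  refine lift (fun | a => (q : ℂ)⁻¹ | b => 0 | c => 0 | d => (q : ℂ)) ?_ ?_ ?_ ?_ ?_ ?_ ?_ <;> simp

variable (s : Circle) (μ : ℝ)

/-- The values on generators of the infinitesimal character annihilating the coideal. -/
def derivGen : Gen → ℂ
  | a => -(2 * (s : ℂ) * μ)
  | b => 1 + (s : ℂ) ^ 2
  | c => -((s : ℂ) ^ 2 * (μ : ℂ) ^ 2 * (1 + (s : ℂ) ^ 2))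
  | d => 2 * (s : ℂ) ^ 3 * μ

/-- The two-dimensional triangular representation `x ↦ (ε(x), Y(x); 0, χ(x))`. -/
def triHom : SLq (s ^ 2) →ₐ[ℂ] Matrix (Fin 2) (Fin 2) ℂ := by
  -- The relation `ab = q ba` forces `Y(b) = q χ(a) Y(b)`, so `χ(a) = q⁻¹` is what permits `Y(b) ≠
  -- 0`. The relation for `ad` forces `Y(d) = -q Y(a)`, and vanishing on the coideal then fixes all
  -- values up to the normalization `Y(b) = 1 + q`.
  refine lift (fun g => !![counitGen g, derivGen s μ g; 0, charHom (s ^ 2) (gen _ g)])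
    ?_ ?_ ?_ ?_ ?_ ?_ ?_ <;>
  · have hs := q_ne_zero (q := s)
    ext i j
    fin_cases i <;> fin_cases j <;> simp [charHom, counitGen, derivGen] <;> field_simp <;> ring

/-- The `(ε, χ)`-derivation `Y` of `SL_q(2)` annihilating the coideal `C_{μν}`, `ν = μ²`. -/
def deriv : SLq (s ^ 2) →ₗ[ℂ] ℂ where
  toFun x := triHom s μ x 0 1
  map_add' x y := by simp
  map_smul' z x := by simp

theorem deriv_gen (g : Gen) : deriv s μ (gen _ g) = derivGen s μ g := by
  simp [deriv, triHom]

theorem triHom_apply (x : SLq (s ^ 2)) : triHom s μ x 0 0 = Coalgebra.counit (R := ℂ) x ∧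
    triHom s μ x 1 0 = 0 ∧ triHom s μ x 1 1 = charHom (s ^ 2) x := by
  induction x using SLq.induction with
  | hs z => simp [Matrix.algebraMap_matrix_apply]
  | hg g => simp [triHom]
  | hm x y hx hy => simp [Matrix.mul_apply, Fin.sum_univ_two, hx, hy]
  | ha x y hx hy => simp [hx, hy]

/-- This is the upper right entry of a product of triangular matrices with diagonals `(ε, χ)`. -/
theorem deriv_mul (x y : SLq (s ^ 2)) : deriv s μ (x * y) =
    Coalgebra.counit (R := ℂ) x * deriv s μ y + deriv s μ x * charHom (s ^ 2) y := by
  simp [deriv, Matrix.mul_apply, Fin.sum_univ_two, triHom_apply]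

/-- The functional induced by `Y` on `R_q`. -/
def derivK : Rq s μ →ₗ[ℂ] ℂ :=
  -- For `c` in the coideal, `Y(c x) = ε(c) Y(x) + Y(c) χ(x)`, and both `ε` and `Y` vanish on `c`.
  Submodule.liftQ _ (deriv s μ) (coisoIdeal_le
    (fun x => by
      rw [LinearMap.mem_ker, deriv_mul]
      simp [coisoGen₁, counitGen, deriv_gen, derivGen]
      left; ring)
    (fun x => by
      rw [LinearMap.mem_ker, deriv_mul]
      simp [coisoGen₂, counitGen, deriv_gen, derivGen]))

/-- The operator on `R_q` given by the action of `Y`. -/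
def opK : Module.End ℂ (Rq s μ) := hit (derivK s μ)

theorem opK_r (x : SLq (s ^ 2)) :
    opK s μ (r s μ (μ ^ 2) x) = r s μ (μ ^ 2) (hit (deriv s μ) x) := by
  change TensorProduct.rid ℂ _ ((derivK s μ).lTensor _ (TensorProduct.map (r s μ (μ ^ 2))
    (r s μ (μ ^ 2)) (Coalgebra.comul x))) =
    r s μ (μ ^ 2) (TensorProduct.rid ℂ _ ((deriv s μ).lTensor _ (Coalgebra.comul x)))
  generalize Coalgebra.comul (R := ℂ) x = t
  induction t with
  | zero => simp
  | add u v hu hv => simp only [map_add, hu, hv]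
  | tmul y z => simp only [TensorProduct.map_tmul, LinearMap.lTensor_tmul, TensorProduct.rid_tmul,
      map_smul]; rfl

/-- The map `x ⊗ y ↦ χ(y) x`. -/
def charRight (q : Circle) : SLq q ⊗[ℂ] SLq q →ₐ[ℂ] SLq q :=
  (Algebra.TensorProduct.rid ℂ ℂ (SLq q)).toAlgHom.comp
    (Algebra.TensorProduct.map (AlgHom.id ℂ _) (charHom q))

theorem charRight_tmul (q : Circle) (x y : SLq q) : charRight q (x ⊗ₜ y) = charHom q y • x := by
  simp [charRight]

/-- The automorphism `x ↦ x₍₁₎ χ(x₍₂₎)` of `SL_q(2)`. -/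
def twist (q : Circle) : SLq q →ₐ[ℂ] SLq q :=
  (charRight q).comp (Bialgebra.comulAlgHom ℂ _)

theorem twist_b (q : Circle) : twist q (gen q b) = (q : ℂ) • gen q b := by
  simp [twist, comulGen, charRight_tmul, charHom]

/-- The twisted Leibniz rule of `Y`, transported to its action: the `ε` term restores `x`, the `χ`
term twists `y`. -/
theorem hit_deriv_mul (x y : SLq (s ^ 2)) : hit (deriv s μ) (x * y) =
    x * hit (deriv s μ) y + hit (deriv s μ) x * twist _ y := by
  have h : ∀ t u : SLq (s ^ 2) ⊗[ℂ] SLq (s ^ 2),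
      TensorProduct.rid ℂ _ ((deriv s μ).lTensor _ (t * u)) =
      TensorProduct.rid ℂ _ ((Coalgebra.counit (R := ℂ)).lTensor _ t) *
        TensorProduct.rid ℂ _ ((deriv s μ).lTensor _ u) +
      TensorProduct.rid ℂ _ ((deriv s μ).lTensor _ t) * charRight _ u := by
    intro t u
    induction t with
    | zero => simp
    | add t t' ht ht' => simp only [map_add, add_mul, ht, ht']; abel
    | tmul x y =>
      induction u with
      | zero => simp
      | add t t' ht ht' => simp only [map_add, mul_add, ht, ht']; abel
      | tmul x' y' =>
        simp [deriv_mul, charRight_tmul]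
        module
  rw [hit_apply, Bialgebra.comul_mul, h, Coalgebra.lTensor_counit_comul]
  simp only [TensorProduct.rid_tmul, one_smul]
  rfl

theorem hit_deriv_b : hit (deriv s μ) (gen _ b) =
    (1 + (s : ℂ) ^ 2) • gen _ a + (2 * (s : ℂ) ^ 3 * μ) • gen _ b := by
  simp [hit_apply, comulGen, deriv_gen, derivGen]

theorem b_pow_mul_a (i : ℕ) : gen (s ^ 2) b ^ i * gen _ a =
    ((s : ℂ) ^ (2 * i))⁻¹ • (gen _ a * gen _ b ^ i) := by
  have hs := q_ne_zero (q := s)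
  induction i with
  | zero => simp
  | succ i ih =>
    have : gen (s ^ 2) b * gen _ a = ((s : ℂ) ^ 2)⁻¹ • (gen _ a * gen _ b) := by
      rw [rel_ab, smul_smul, Circle.coe_pow, inv_mul_cancel₀ (pow_ne_zero _ hs), one_smul]
    rw [pow_succ (gen _ b), mul_assoc, this, mul_smul_comm, ← mul_assoc, ih, smul_mul_assoc, smul_smul,
      mul_assoc]
    congr 1
    rw [mul_add, pow_add, mul_inv]
    ring

theorem qNum_sq (n : ℕ) : qNum ((s : ℂ) ^ 2) n =
    ((s : ℂ) ^ (2 * n) - ((s : ℂ) ^ (2 * n))⁻¹) * (s : ℂ) ^ 2 /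
      (((s : ℂ) ^ 2 - 1) * ((s : ℂ) ^ 2 + 1)) := by
  have hs := q_ne_zero (q := s)
  have : (s : ℂ) ^ 2 - ((s : ℂ) ^ 2)⁻¹ =
      (((s : ℂ) ^ 2 - 1) * ((s : ℂ) ^ 2 + 1)) / (s : ℂ) ^ 2 := by
    field_simp
    ring
  rw [qNum, ← pow_mul, this, div_div_eq_mul_div]

theorem hit_deriv_b_pow (hq : (s : ℂ) ^ 2 - 1 ≠ 0) (hq' : (s : ℂ) ^ 2 + 1 ≠ 0) (i : ℕ) :
    hit (deriv s μ) (gen _ b ^ (i + 1)) =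
    ((1 + (s : ℂ) ^ 2) * qNum ((s : ℂ) ^ 2) (i + 1)) • (gen _ a * gen _ b ^ i) +
      (2 * (s : ℂ) ^ 3 * μ * (((s : ℂ) ^ (2 * (i + 1)) - 1) / ((s : ℂ) ^ 2 - 1))) •
        gen _ b ^ (i + 1) := by
  have hs := q_ne_zero (q := s)
  have h4 := mul_ne_zero hq hq'
  have e1 := qNum_sq s
  induction i with
  | zero =>
    rw [zero_add, pow_one, hit_deriv_b, e1]
    simp only [pow_zero, mul_one]
    congr 2
    · field_simp
      ring
    · field_simp
  | succ i ih =>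
    rw [pow_succ (gen _ b), hit_deriv_mul, ih, twist_b, hit_deriv_b, mul_add, mul_smul_comm, mul_smul_comm,
      b_pow_mul_a, e1, e1]
    simp only [add_mul, smul_mul_assoc, mul_smul_comm, smul_smul, mul_assoc, ← pow_succ,
      Circle.coe_pow]
    match_scalars
    · field_simp
      ring
    · field_simp
      ring

/-- The eigenvalue of `opK` on `v_n`. -/
def eigval (n : ℕ) : ℂ :=
  (s : ℂ) ^ 3 * μ / ((s : ℂ) ^ 2 - 1) * ((s : ℂ) ^ (2 * n) + ((s : ℂ) ^ (2 * n))⁻¹ - 2)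

section

variable (hs : ∀ n : ℕ, 0 < n → (s ^ 2) ^ n ≠ 1)
include hs

theorem pow_ne_one (n : ℕ) (hn : 0 < n) : (s : ℂ) ^ (2 * n) ≠ 1 := by
  intro h
  apply hs n hn
  rw [← pow_mul]
  exact Circle.ext (by simpa using h)

theorem sq_sub_one_ne_zero : (s : ℂ) ^ 2 - 1 ≠ 0 := by
  simpa [sub_eq_zero] using pow_ne_one s hs 1 one_pos

theorem sq_add_one_ne_zero : (s : ℂ) ^ 2 + 1 ≠ 0 := by
  intro h
  have h4 : (s : ℂ) ^ (2 * 2) = 1 := by linear_combination ((s : ℂ) ^ 2 - 1) * h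
  exact pow_ne_one s hs 2 two_pos h4

theorem qNum_ne_zero (n : ℕ) (hn : 0 < n) : qNum ((s : ℂ) ^ 2) n ≠ 0 := by
  have h0 := q_ne_zero (q := s)
  have h1 := sq_sub_one_ne_zero s hs
  have h2 := sq_add_one_ne_zero s hs
  rw [qNum_sq]
  refine div_ne_zero (mul_ne_zero ?_ (pow_ne_zero _ h0)) (mul_ne_zero h1 h2)
  intro h
  apply pow_ne_one s hs (2 * n) (by positivity)
  have h3 : (s : ℂ) ^ (2 * n) ≠ 0 := pow_ne_zero _ h0
  field_simp at h
  rw [show 2 * (2 * n) = 2 * n * 2 by ring, pow_mul]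
  linear_combination h

/-- Equality of `q^m + q^{-m}` and `q^n + q^{-n}` factors as `(q^{n-m} - 1)(q^{n+m} - 1) = 0`, which
is impossible for `m < n` since `q` is not a root of unity. -/
theorem eigval_injective (hμ : μ ≠ 0) : Function.Injective (eigval s μ) := by
  have h0 := q_ne_zero (q := s)
  have hμ' : (μ : ℂ) ≠ 0 := by exact_mod_cast hμ
  have aux : ∀ m k : ℕ, 0 < k → eigval s μ m ≠ eigval s μ (m + k) := by
    intro m k hk h
    have hA : (s : ℂ) ^ 3 * μ / ((s : ℂ) ^ 2 - 1) ≠ 0 :=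
      div_ne_zero (mul_ne_zero (pow_ne_zero _ h0) hμ') (sq_sub_one_ne_zero s hs)
    have h' := mul_left_cancel₀ hA h
    have hm : (s : ℂ) ^ (2 * m) ≠ 0 := pow_ne_zero _ h0
    have hk' : (s : ℂ) ^ (2 * k) ≠ 0 := pow_ne_zero _ h0
    rw [mul_add, pow_add] at h'
    have h3 : ((s : ℂ) ^ (2 * k) - 1) * ((s : ℂ) ^ (2 * (m + m + k)) - 1) = 0 := by
      rw [mul_add, mul_add, pow_add, pow_add]
      field_simp at h'
      linear_combination -h'
    rcases mul_eq_zero.mp h3 with h4 | h4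
    · exact pow_ne_one s hs k hk (sub_eq_zero.mp h4)
    · exact pow_ne_one s hs _ (by omega) (sub_eq_zero.mp h4)
  intro m n h
  rcases lt_trichotomy m n with hl | hl | hl
  · obtain ⟨k, rfl⟩ := Nat.exists_eq_add_of_lt hl
    exact absurd h (aux m (k + 1) (by omega))
  · exact hl
  · obtain ⟨k, rfl⟩ := Nat.exists_eq_add_of_lt hl
    exact absurd h.symm (aux n (k + 1) (by omega))

/-- Since `ε(w_n) = 1` and `χ(b) = 0`, the twisted Leibniz rule gives the recursion `λ_{n+1} = Y(a +
t_n b) + q⁻¹ λ_n`. -/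
theorem derivK_v (n : ℕ) : derivK s μ (v s μ n) = eigval s μ n := by
  have h0 := q_ne_zero (q := s)
  have h1 := sq_sub_one_ne_zero s hs
  change deriv s μ (w s μ n) = _
  induction n with
  | zero =>
    have h : deriv s μ 1 = 0 := by simp [deriv]
    rw [w, h, eigval]
    norm_num
  | succ n ih =>
    have hc : Coalgebra.counit (R := ℂ) (w s μ n) = 1 := (isGroupLikeElem_v s μ n).counit_eq_one
    rw [w_succ, deriv_mul, hc, ih, eigval, eigval]
    simp [deriv_gen, derivGen, charHom]
    have hm : (s : ℂ) ^ (2 * n) ≠ 0 := pow_ne_zero _ h0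
    rw [show 2 * (n + 1) = 2 * n + 2 by ring]
    simp only [pow_add]
    field_simp
    ring

theorem opK_v (n : ℕ) : opK s μ (v s μ n) = eigval s μ n • v s μ n := by
  rw [opK, (isGroupLikeElem_v s μ n).hit_eq, derivK_v s μ hs]

/-- `D` is triangular on the `v_k · b^j` with `k + j` fixed. The diagonal coefficient is written as
`λ_{k+j}` plus a defect proportional to `[j]_q [k]_q`; this defect drives the telescoping in
`opK_X`. -/
theorem opK_r_w_mul_b_pow (k i : ℕ) : opK s μ (r s μ (μ ^ 2) (w s μ k * gen _ b ^ (i + 1))) =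
    ((1 + (s : ℂ) ^ 2) * qNum ((s : ℂ) ^ 2) (i + 1)) •
        r s μ (μ ^ 2) (w s μ (k + 1) * gen _ b ^ i) +
      (eigval s μ (k + (i + 1)) - (1 + (s : ℂ) ^ 2) * ((s : ℂ) ^ 2 - ((s : ℂ) ^ 2)⁻¹) * (s * μ) *
        qNum ((s : ℂ) ^ 2) (i + 1) * qNum ((s : ℂ) ^ 2) k) •
        r s μ (μ ^ 2) (w s μ k * gen _ b ^ (i + 1)) := by
  have h0 := q_ne_zero (q := s)
  have h1 := sq_sub_one_ne_zero s hs
  have h2 := sq_add_one_ne_zero s hs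
  have ht : r s μ (μ ^ 2) (hit (deriv s μ) (w s μ k) * twist _ (gen _ b ^ (i + 1))) =
      (((s : ℂ) ^ 2) ^ (i + 1) * eigval s μ k) •
        r s μ (μ ^ 2) (w s μ k * gen _ b ^ (i + 1)) := by
    have := opK_v s μ hs k
    rw [v, opK_r] at this
    rw [map_pow, twist_b, smul_pow, mul_smul_comm, map_smul, ← act_r, this, map_smul, act_r,
      smul_smul, Circle.coe_pow]
  -- The Leibniz rule yields `w_k a b^i`, which is expressed through the next `w` by `w_k a =
  -- w_{k+1} - t_k w_k b`.
  have hw : w s μ k * (gen _ a * gen _ b ^ i) = w s μ (k + 1) * gen _ b ^ i -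
      ((s : ℂ) ^ (2 * k + 1) * (μ : ℂ)) • (w s μ k * gen _ b ^ (i + 1)) := by
    rw [w_succ, mul_add, add_mul, mul_assoc, mul_smul_comm, smul_mul_assoc, mul_assoc (w s μ k),
      ← pow_succ', add_sub_cancel_right]
  rw [opK_r, hit_deriv_mul, map_add, ht, hit_deriv_b_pow s μ h1 h2, mul_add, mul_smul_comm, hw,
    mul_smul_comm]
  simp only [map_add, map_sub, map_smul]
  match_scalars
  · ring
  · have hm : (s : ℂ) ^ (2 * k) ≠ 0 := pow_ne_zero _ h0
    have hi : (s : ℂ) ^ (2 * i) ≠ 0 := pow_ne_zero _ h0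
    simp only [qNum_sq, eigval, ← pow_mul, mul_add, mul_one]
    simp only [pow_add, pow_one]
    generalize (s : ℂ) ^ (2 * i) = I at *
    generalize (s : ℂ) ^ (2 * k) = J at *
    field_simp
    ring

/-- The coefficients of `X_{n+1}` are chosen so that the raising term of each summand cancels the
defect of the preceding one. Only the initial boundary term, a multiple of `v_{n+1}`, survives. -/
theorem opK_X (n : ℕ) : opK s μ (X s μ (n + 1)) = eigval s μ (n + 1) • X s μ (n + 1) +
    ((1 + (s : ℂ) ^ 2) * (s * μ)) • v s μ (n + 1) := by
  set q : ℂ := (s : ℂ) ^ 2 with hq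
  have hfac : ∀ j ≤ n, qFact q n = (∏ l ∈ Finset.range j, qNum q (n - l)) * qFact q (n - j) := by
    intro j hj
    induction j with
    | zero => simp
    | succ j ih =>
      rw [ih (by omega), Finset.prod_range_succ]
      obtain ⟨k, hk⟩ : ∃ k, n - j = k + 1 := ⟨n - (j + 1), by omega⟩
      have hk' : n - (j + 1) = k := by omega
      rw [hk, hk', qFact, qFact, Finset.prod_range_succ]
      ring
  have hF : ∀ j, qFact q j ≠ 0 := fun j =>
    Finset.prod_ne_zero_iff.mpr fun l _ => qNum_ne_zero s hs _ (by omega)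
  set P : ℕ → ℂ := fun j => ∏ l ∈ Finset.range j, qNum q (n - l) with hP
  -- Reindex by `j = i - 1` and replace the quotient of factorials by the falling product `P j =
  -- [n]_q [n-1]_q ⋯ [n-j+1]_q`.
  have hX : X s μ (n + 1) = ∑ j ∈ Finset.range (n + 1),
      ((q - q⁻¹) ^ j * (s * μ) ^ (j + 1) * P j / qNum q (j + 1)) •
        r s μ (μ ^ 2) (w s μ (n - j) * gen _ b ^ (j + 1)) := by
    rw [X, Finset.range_eq_Ico, ← Finset.Ico_add_one_right_eq_Icc,
      Finset.sum_Ico_eq_sum_range, Finset.range_eq_Ico]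
    refine Finset.sum_congr rfl fun j hj => ?_
    have hj' : j ≤ n := by have := (Finset.mem_Ico.mp hj).2; omega
    have e1 : n + 1 - (1 + j) = n - j := by omega
    rw [e1, add_comm 1 j, Nat.add_sub_cancel, Nat.add_sub_cancel]
    congr 1
    have h1 := hF (n - j)
    have h2 := qNum_ne_zero s hs (j + 1) (by omega)
    rw [← hq] at h2 ⊢
    rw [hfac j hj', mul_pow]
    simp only [hP]
    field_simp
  set f : ℕ → Rq s μ := fun j => ((1 + q) * (q - q⁻¹) ^ j * (s * μ) ^ (j + 1) * P j) •
    r s μ (μ ^ 2) (w s μ (n + 1 - j) * gen _ b ^ j) with hf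
  have hD : ∀ j ∈ Finset.range (n + 1),
      opK s μ (((q - q⁻¹) ^ j * (s * μ) ^ (j + 1) * P j / qNum q (j + 1)) •
        r s μ (μ ^ 2) (w s μ (n - j) * gen _ b ^ (j + 1))) =
      eigval s μ (n + 1) • (((q - q⁻¹) ^ j * (s * μ) ^ (j + 1) * P j / qNum q (j + 1)) •
        r s μ (μ ^ 2) (w s μ (n - j) * gen _ b ^ (j + 1))) + (f j - f (j + 1)) := by
    intro j hj
    have hj' : j ≤ n := by have := Finset.mem_range.mp hj; omega
    have h2 := qNum_ne_zero s hs (j + 1) (by omega)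
    have e1 : n - j + (j + 1) = n + 1 := by omega
    have e2 : n - j + 1 = n + 1 - j := by omega
    have e3 : n + 1 - (j + 1) = n - j := by omega
    rw [map_smul, opK_r_w_mul_b_pow s μ hs, e1, e2]
    simp only [hf, e3]
    have hP' : P (j + 1) = P j * qNum q (n - j) := Finset.prod_range_succ _ _
    rw [hP']
    rw [← hq] at h2 ⊢
    match_scalars <;> field_simp
    ring
  -- The last factor of `P (n + 1)` is `[0]_q = 0`.
  have hend : f (n + 1) = 0 := by
    have : P (n + 1) = 0 := by
      simp only [hP, Finset.prod_range_succ]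
      simp [qNum]
    simp [hf, this]
  rw [hX, map_sum, Finset.sum_congr rfl hD, Finset.sum_add_distrib, Finset.sum_range_sub', hend,
    sub_zero, Finset.smul_sum]
  simp [hf, hP, v]

end

/-! ### The homogeneous spans of the vectors `v_k · b^i` -/

theorem counit_X (n : ℕ) : Coalgebra.counit (R := ℂ) (X s μ n) = 0 := by
  rw [X, map_sum]
  refine Finset.sum_eq_zero fun i hi => ?_
  have hi' : i ≠ 0 := by have := (Finset.mem_Icc.mp hi).1; omega
  rw [map_smul]
  have : Coalgebra.counit (R := ℂ) (w s μ (n - i) * gen _ b ^ i) = 0 := by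
    simp [counitGen, hi']
  change _ • Coalgebra.counit (R := ℂ) (w s μ (n - i) * gen _ b ^ i) = 0
  rw [this, smul_zero]

/-- The vector `v_k · b^i`. -/
def monom (k i : ℕ) : Rq s μ := r s μ (μ ^ 2) (w s μ k * gen _ b ^ i)

theorem monom_zero (k : ℕ) : monom s μ k 0 = v s μ k := by simp [monom, v]

theorem act_b_pow_monom (k i j : ℕ) : act s μ (gen _ b ^ j) (monom s μ k i) =
    monom s μ k (i + j) := by
  rw [monom, act_r, mul_assoc, ← pow_add, monom]

/-- The span of the vectors `v_k · b^i` with `k + i = n`. -/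
def homSpan (n : ℕ) : Submodule ℂ (Rq s μ) :=
  Submodule.span ℂ (Set.range fun i : Fin (n + 1) => monom s μ (n - i) i)

instance (n : ℕ) : FiniteDimensional ℂ (homSpan s μ n) :=
  FiniteDimensional.span_of_finite ℂ (Set.finite_range _)

theorem finrank_homSpan_le (n : ℕ) : Module.finrank ℂ (homSpan s μ n) ≤ n + 1 := by
  simpa using! finrank_range_le_card (R := ℂ) (fun i : Fin (n + 1) => monom s μ (n - i) i)

theorem monom_mem {k i n : ℕ} (h : k + i = n) : monom s μ k i ∈ homSpan s μ n :=
  Submodule.subset_span ⟨⟨i, by omega⟩, by simp [← h]⟩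

theorem homSpan_le {n : ℕ} {N : Submodule ℂ (Rq s μ)}
    (h : ∀ k i, k + i = n → monom s μ k i ∈ N) : homSpan s μ n ≤ N := by
  refine Submodule.span_le.mpr ?_
  rintro _ ⟨i, rfl⟩
  exact h _ _ (by omega)

theorem act_b_monom (k i : ℕ) : act s μ (gen _ b) (monom s μ k i) = monom s μ k (i + 1) := by
  simpa using act_b_pow_monom s μ k i 1

theorem act_a_v (k : ℕ) : act s μ (gen _ a) (v s μ k) =
    v s μ (k + 1) - ((s : ℂ) ^ (2 * k + 1) * (μ : ℂ)) • monom s μ k 1 := by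
  simp only [v, monom, act_r, w_succ, pow_one, mul_add, map_add, mul_smul_comm, map_smul,
    add_sub_cancel_right]

theorem act_c_v (k : ℕ) : act s μ (gen _ c) (v s μ k) =
    (-((s : ℂ) ^ 2 * (μ : ℂ) ^ 2)) • monom s μ k 1 := by
  rw [v, act_r, r_w_mul_c, monom, pow_one]

theorem act_mul (x y : SLq (s ^ 2)) (z : Rq s μ) :
    act s μ (x * y) z = act s μ y (act s μ x z) := by
  obtain ⟨z, rfl⟩ := Submodule.mkQ_surjective _ z
  exact congrArg (r s μ (μ ^ 2)) (mul_assoc z x y).symm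

theorem act_add (x y : SLq (s ^ 2)) (z : Rq s μ) :
    act s μ (x + y) z = act s μ x z + act s μ y z := by
  obtain ⟨z, rfl⟩ := Submodule.mkQ_surjective _ z
  simp only [act_r, mul_add, map_add]

theorem act_smul (t : ℂ) (x : SLq (s ^ 2)) (z : Rq s μ) :
    act s μ (t • x) z = t • act s μ x z := by
  obtain ⟨z, rfl⟩ := Submodule.mkQ_surjective _ z
  simp only [act_r, mul_smul_comm, map_smul]

theorem act_one (z : Rq s μ) : act s μ 1 z = z := by
  obtain ⟨z, rfl⟩ := Submodule.mkQ_surjective _ z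
  simp only [act_r, mul_one]

theorem b_pow_mul_c (i : ℕ) : gen (s ^ 2) b ^ i * gen _ c = gen _ c * gen _ b ^ i :=
  (Commute.pow_left (rel_bc (q := s ^ 2)) i)

theorem b_pow_mul_d (i : ℕ) : gen (s ^ 2) b ^ i * gen _ d =
    (s : ℂ) ^ (2 * i) • (gen _ d * gen _ b ^ i) := by
  induction i with
  | zero => simp
  | succ i ih =>
    rw [pow_succ (gen _ b), mul_assoc, rel_bd, mul_smul_comm, ← mul_assoc, ih, smul_mul_assoc,
      smul_smul, mul_assoc, Circle.coe_pow]
    congr 1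
    ring

section

variable (hμ : μ ≠ 0)
include hμ

theorem act_d_v (k : ℕ) : act s μ (gen _ d) (v s μ k) =
    v s μ (k + 1) + ((s : ℂ) * (μ : ℂ) * ((s : ℂ) ^ (2 * k))⁻¹) • monom s μ k 1 := by
  rw [v, act_r, r_w_mul_d s μ hμ, monom, v, pow_one]

/-- The sum of these spans is stable under the right action: `b^i` commutes past `a`, `c`, `d` up to
a scalar, and `v_k · a`, `v_k · c`, `v_k · d` are combinations of `v_{k+1}` and `v_k · b`. It
contains `v_0`, which generates `R_q` as a right module. -/
theorem iSup_homSpan : ⨆ n, homSpan s μ n = ⊤ := by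
  have hm : ∀ k i, monom s μ k i ∈ ⨆ n, homSpan s μ n := fun k i =>
    Submodule.mem_iSup_of_mem (k + i) (monom_mem s μ rfl)
  have hmon : ∀ k i, monom s μ k i = act s μ (gen _ b ^ i) (v s μ k) := fun k i => by
    rw [← monom_zero, act_b_pow_monom, zero_add]
  have hact : ∀ x : SLq (s ^ 2), ∀ y ∈ ⨆ n, homSpan s μ n,
      act s μ x y ∈ ⨆ n, homSpan s μ n := by
    intro x
    induction x using SLq.induction with
    | hs z =>
      intro y hy
      rw [Algebra.algebraMap_eq_smul_one, act_smul, act_one]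
      exact Submodule.smul_mem _ _ hy
    | hg g =>
      suffices h : ∀ k i, act s μ (gen _ g) (monom s μ k i) ∈ ⨆ n, homSpan s μ n by
        exact (iSup_le fun n => homSpan_le s μ (N := (⨆ n, homSpan s μ n).comap (act s μ (gen _ g)))
          fun k i _ => h k i : (⨆ n, homSpan s μ n) ≤ _)
      intro k i
      cases g with
      | a =>
        rw [hmon, ← act_mul, b_pow_mul_a, act_smul, act_mul, act_a_v, map_sub, map_smul,
          ← hmon, act_b_pow_monom]
        exact Submodule.smul_mem _ _ (Submodule.sub_mem _ (hm _ _) (Submodule.smul_mem _ _ (hm _ _)))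
      | b => rw [act_b_monom]; exact hm _ _
      | c =>
        rw [hmon, ← act_mul, b_pow_mul_c, act_mul, act_c_v, map_smul, act_b_pow_monom]
        exact Submodule.smul_mem _ _ (hm _ _)
      | d =>
        rw [hmon, ← act_mul, b_pow_mul_d, act_smul, act_mul, act_d_v s μ hμ, map_add, map_smul,
          ← hmon, act_b_pow_monom]
        exact Submodule.smul_mem _ _ (Submodule.add_mem _ (hm _ _) (Submodule.smul_mem _ _ (hm _ _)))
    | hm x y hx hy => intro z hz; rw [act_mul]; exact hy _ (hx _ hz)
    | ha x y hx hy => intro z hz; rw [act_add]; exact Submodule.add_mem _ (hx _ hz) (hy _ hz)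
  rw [eq_top_iff]
  rintro x -
  obtain ⟨x, rfl⟩ := Submodule.mkQ_surjective _ x
  have h := hact x (v s μ 0) (by rw [← monom_zero]; exact hm _ _)
  rwa [v, w, act_r, one_mul] at h

/-- Expand `v_k = v_k · (ad - q bc)`: each of the two generators raises the degree by one. -/
theorem homSpan_le_add_two (n : ℕ) : homSpan s μ n ≤ homSpan s μ (n + 2) := by
  have hv : ∀ k, ∃ x y : ℂ,
      v s μ k = monom s μ (k + 2) 0 + x • monom s μ (k + 1) 1 + y • monom s μ k 2 := by
    intro k
    have h := act_one s μ (v s μ k)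
    have hd : act s μ (gen _ d) (monom s μ k 1) = (s : ℂ) ^ (2 * 1) • (monom s μ (k + 1) 1 +
        ((s : ℂ) * (μ : ℂ) * ((s : ℂ) ^ (2 * k))⁻¹) • monom s μ k 2) := by
      have hb := act_b_pow_monom s μ k 0 1
      have hb' := act_b_pow_monom s μ (k + 1) 0 1
      rw [zero_add] at hb hb'
      rw [← hb, ← act_mul, b_pow_mul_d, act_smul, act_mul, monom_zero, act_d_v s μ hμ, map_add,
        map_smul, act_b_pow_monom, ← monom_zero, hb']
    rw [← rel_ad, sub_eq_add_neg, ← neg_smul, act_add, act_smul, act_mul, rel_bc, act_mul,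
      act_a_v, act_c_v, map_sub, map_smul, map_smul, act_d_v s μ hμ, act_b_monom, hd,
      ← monom_zero s μ (k + 1 + 1)] at h
    refine ⟨((s : ℂ) * (μ : ℂ) * ((s : ℂ) ^ (2 * (k + 1)))⁻¹) -
        ((s : ℂ) ^ (2 * k + 1) * (μ : ℂ)) * (s : ℂ) ^ (2 * 1),
      - (((s : ℂ) ^ (2 * k + 1) * (μ : ℂ)) * (s : ℂ) ^ (2 * 1) *
        ((s : ℂ) * (μ : ℂ) * ((s : ℂ) ^ (2 * k))⁻¹)) +
        (((s ^ 2 : Circle) : ℂ)) * ((s : ℂ) ^ 2 * (μ : ℂ) ^ 2), h.symm.trans ?_⟩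
    module
  refine homSpan_le s μ fun k i hki => ?_
  obtain ⟨x, y, h⟩ := hv k
  rw [← zero_add i, ← act_b_pow_monom, monom_zero, h]
  simp only [map_add, map_smul, act_b_pow_monom]
  exact add_mem (add_mem (monom_mem s μ (by omega)) (Submodule.smul_mem _ _
    (monom_mem s μ (by omega)))) (Submodule.smul_mem _ _ (monom_mem s μ (by omega)))

end

theorem X_mem_homSpan (n : ℕ) : X s μ n ∈ homSpan s μ n :=
  Submodule.sum_mem _ fun i hi => Submodule.smul_mem _ _ <| monom_mem s μ <| by
    have := (Finset.mem_Icc.mp hi).2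
    omega

theorem v_mem_homSpan (n : ℕ) : v s μ n ∈ homSpan s μ n := by
  rw [← monom_zero]
  exact monom_mem s μ rfl

theorem component_zero : component s μ 0 = Submodule.span ℂ {v s μ 0} := if_pos rfl

theorem component_succ (n : ℕ) :
    component s μ (n + 1) = Submodule.span ℂ {v s μ (n + 1), X s μ (n + 1)} := if_neg (by omega)

theorem v_mem_component (n : ℕ) : v s μ n ∈ component s μ n := by
  cases n with
  | zero => rw [component_zero]; exact Submodule.subset_span rfl
  | succ n => rw [component_succ]; exact Submodule.subset_span (by simp)

theorem component_le {n : ℕ} {N : Submodule ℂ (Rq s μ)} (hv : v s μ n ∈ N)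
    (hX : n ≠ 0 → X s μ n ∈ N) : component s μ n ≤ N := by
  cases n with
  | zero => rw [component_zero, Submodule.span_le]; simpa using hv
  | succ n =>
    rw [component_succ, Submodule.span_le]
    rintro _ (rfl | rfl)
    exacts [hv, hX (by omega)]

theorem component_le_homSpan (n : ℕ) : component s μ n ≤ homSpan s μ n :=
  component_le s μ (v_mem_homSpan s μ n) fun _ => X_mem_homSpan s μ n

/-! ### Spectral decomposition of `R_q` into the components -/

section

variable (hs : ∀ n : ℕ, 0 < n → (s ^ 2) ^ n ≠ 1)
include hs

theorem opK_sub_eigval_v (n : ℕ) : (opK s μ - eigval s μ n • 1) (v s μ n) = 0 := by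
  simp [opK_v s μ hs]

theorem opK_sub_eigval_X (n : ℕ) :
    (opK s μ - eigval s μ (n + 1) • 1) (X s μ (n + 1)) =
      ((1 + (s : ℂ) ^ 2) * (s * μ)) • v s μ (n + 1) := by
  simp [opK_X s μ hs]

theorem component_le_maxGenEigenspace (n : ℕ) :
    component s μ n ≤ (opK s μ).maxGenEigenspace (eigval s μ n) := by
  refine component_le s μ ?_ fun hn => ?_
  · rw [Module.End.mem_maxGenEigenspace]
    exact ⟨1, by rw [pow_one]; exact opK_sub_eigval_v s μ hs n⟩
  · obtain ⟨n, rfl⟩ := Nat.exists_eq_succ_of_ne_zero hn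
    rw [Module.End.mem_maxGenEigenspace]
    refine ⟨2, ?_⟩
    have h1 := opK_sub_eigval_X s μ hs n
    have h2 := opK_sub_eigval_v s μ hs (n + 1)
    rw [sq (opK s μ - _), Module.End.mul_apply, Nat.succ_eq_add_one, h1, map_smul, h2, smul_zero]

variable (hμ : μ ≠ 0)
include hμ

theorem opK_X_coeff_ne_zero : (1 + (s : ℂ) ^ 2) * (s * μ) ≠ 0 := by
  have hμ' : (μ : ℂ) ≠ 0 := by exact_mod_cast hμ
  have := sq_add_one_ne_zero s hs
  rw [add_comm] at this
  exact mul_ne_zero this (mul_ne_zero (q_ne_zero (q := s)) hμ')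

/-- The components sit inside generalized eigenspaces of `D` for distinct eigenvalues. -/
theorem iSupIndep_component : iSupIndep (component s μ) :=
  ((opK s μ).independent_maxGenEigenspace.comp (eigval_injective s μ hs hμ)).mono
    (component_le_maxGenEigenspace s μ hs)

theorem finrank_component_succ (n : ℕ) : Module.finrank ℂ (component s μ (n + 1)) = 2 := by
  have h : LinearIndependent ℂ ![v s μ (n + 1), X s μ (n + 1)] := by
    rw [LinearIndependent.pair_iff]
    intro x y h
    have h' := congrArg (opK s μ - eigval s μ (n + 1) • (1 : Module.End ℂ (Rq s μ))) h
    rw [map_add, map_smul, map_smul, opK_sub_eigval_v s μ hs, opK_sub_eigval_X s μ hs, smul_zero,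
      zero_add, map_zero, smul_smul, smul_eq_zero, mul_eq_zero] at h'
    have hv := (isGroupLikeElem_v s μ (n + 1)).ne_zero
    have hy : y = 0 := by simpa [opK_X_coeff_ne_zero s μ hs hμ, hv] using h'
    subst hy
    simpa [hv] using h
  have := finrank_span_eq_card h
  rw [component_succ, ← Matrix.range_cons_cons_empty _ _ ![]]
  simpa using this

/-- A squeeze of dimensions in steps of two: `homSpan (n + 2)` has at most `n + 3` generators, yet
contains the direct sum of `homSpan n`, of dimension `n + 1`, and of a two-dimensional component. So
it equals that sum. The second conjunct is carried along because it supplies the disjointness. -/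
theorem homSpan_eq (n : ℕ) : Module.finrank ℂ (homSpan s μ n) = n + 1 ∧
    homSpan s μ n ≤ ⨆ m, ⨆ (_ : m ≤ n), component s μ m := by
  induction n using Nat.twoStepInduction with
  | zero =>
    have h : homSpan s μ 0 = component s μ 0 := by
      refine le_antisymm (homSpan_le s μ fun k i h => ?_) (component_le_homSpan s μ 0)
      obtain rfl : k = 0 := by omega
      obtain rfl : i = 0 := by omega
      rw [monom_zero]
      exact v_mem_component s μ 0
    refine ⟨?_, h ▸ le_iSup₂_of_le 0 le_rfl le_rfl⟩
    rw [h, component_zero, finrank_span_singleton (isGroupLikeElem_v s μ 0).ne_zero]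
  | one =>
    have h := Submodule.eq_of_le_of_finrank_le (component_le_homSpan s μ 1)
      ((finrank_homSpan_le s μ 1).trans (finrank_component_succ s μ hs hμ 0).ge)
    exact ⟨h ▸ finrank_component_succ s μ hs hμ 0, h ▸ le_iSup₂_of_le 1 le_rfl le_rfl⟩
  | more n ih _ =>
    have hle : homSpan s μ n ⊔ component s μ (n + 2) ≤ homSpan s μ (n + 2) :=
      sup_le (homSpan_le_add_two s μ hμ n) (component_le_homSpan s μ _)
    have hdis : homSpan s μ n ⊓ component s μ (n + 2) = ⊥ := by
      rw [inf_comm, ← disjoint_iff]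
      refine (iSupIndep_component s μ hs hμ (n + 2)).mono_right (ih.2.trans ?_)
      exact iSup₂_le fun m hm => le_iSup₂_of_le m (by omega) le_rfl
    have : FiniteDimensional ℂ (component s μ (n + 2)) :=
      Submodule.finiteDimensional_of_le (component_le_homSpan s μ _)
    have hf := Submodule.finrank_sup_add_finrank_inf_eq (homSpan s μ n) (component s μ (n + 2))
    rw [hdis, finrank_bot, ih.1, finrank_component_succ s μ hs hμ (n + 1), add_zero] at hf
    have h := Submodule.eq_of_le_of_finrank_le hle
      ((finrank_homSpan_le s μ (n + 2)).trans hf.ge)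
    refine ⟨h ▸ hf, ?_⟩
    rw [← h]
    exact sup_le (ih.2.trans (iSup₂_le fun m hm => le_iSup₂_of_le m (by omega) le_rfl))
      (le_iSup₂_of_le (n + 2) le_rfl le_rfl)

theorem iSup_component : ⨆ n, component s μ n = ⊤ := by
  rw [eq_top_iff, ← iSup_homSpan s μ hμ]
  exact iSup_le fun n => (homSpan_eq s μ hs hμ n).2.trans
    (iSup₂_le fun m _ => le_iSup (component s μ) m)

theorem isInternal_component : DirectSum.IsInternal (component s μ) :=
  DirectSum.isInternal_submodule_of_iSupIndep_of_iSup_eq_top (iSupIndep_component s μ hs hμ)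
    (iSup_component s μ hs hμ)

/-- The generalized eigenspaces of `opK` are the components. -/
theorem exists_mem_component {x : Rq s μ} (hx : x ≠ 0) {t : ℂ}
    (h : x ∈ (opK s μ).maxGenEigenspace t) : ∃ n, t = eigval s μ n ∧ x ∈ component s μ n := by
  have hle := component_le_maxGenEigenspace s μ hs
  have hind := (opK s μ).independent_maxGenEigenspace
  by_cases ht : ∃ n, t = eigval s μ n
  · obtain ⟨n, rfl⟩ := ht
    refine ⟨n, rfl, ?_⟩
    have htop : x ∈ component s μ n ⊔ ⨆ m, ⨆ (_ : m ≠ n), component s μ m := by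
      have : component s μ n ⊔ ⨆ m, ⨆ (_ : m ≠ n), component s μ m = ⊤ := by
        rw [eq_top_iff, ← iSup_component s μ hs hμ]
        refine iSup_le fun m => ?_
        by_cases hm : m = n
        · exact hm ▸ le_sup_left
        · exact le_trans (le_iSup₂ (f := fun m (_ : m ≠ n) => component s μ m) m hm) le_sup_right
      rw [this]; trivial
    obtain ⟨y, hy, z, hz, rfl⟩ := Submodule.mem_sup.mp htop
    -- The part `z` of `x` from the other components lies both in the generalized eigenspace of
    -- `λ_n` and in the sum of those for other eigenvalues, so it vanishes.
    have hz1 : z ∈ (opK s μ).maxGenEigenspace (eigval s μ n) := by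
      simpa using Submodule.sub_mem _ h (hle n hy)
    have hz2 : z = 0 := by
      refine Submodule.disjoint_def.mp (hind (eigval s μ n)) z hz1 ?_
      refine (iSup₂_le fun m hm => ?_ : (⨆ m, ⨆ (_ : m ≠ n), component s μ m) ≤ _) hz
      exact (hle m).trans
        (le_iSup₂_of_le _ (fun e => hm (eigval_injective s μ hs hμ e)) le_rfl)
    rwa [hz2, add_zero]
  · refine absurd (Submodule.disjoint_def.mp (hind t) x h ?_) hx
    have : (⊤ : Submodule ℂ (Rq s μ)) ≤ ⨆ t', ⨆ (_ : t' ≠ t), (opK s μ).maxGenEigenspace t' := by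
      rw [← iSup_component s μ hs hμ]
      exact iSup_le fun n => (hle n).trans
        (le_iSup₂_of_le _ (fun e => ht ⟨n, e.symm⟩) le_rfl)
    exact this trivial

/-- The eigenvectors of `opK` are the multiples of the `v_n`. -/
theorem exists_eq_smul_v {x : Rq s μ} (hx : x ≠ 0) {t : ℂ} (h : opK s μ x = t • x) :
    ∃ n, t = eigval s μ n ∧ ∃ z : ℂ, x = z • v s μ n := by
  obtain ⟨n, rfl, hn⟩ := exists_mem_component s μ hs hμ hx
    (Module.End.eigenspace_le_maxGenEigenspace (Module.End.mem_eigenspace_iff.mpr h))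
  refine ⟨n, rfl, ?_⟩
  cases n with
  | zero =>
    rw [component_zero, Submodule.mem_span_singleton] at hn
    obtain ⟨z, rfl⟩ := hn
    exact ⟨z, rfl⟩
  | succ n =>
    rw [component_succ, Submodule.mem_span_pair] at hn
    obtain ⟨y, z, rfl⟩ := hn
    -- Applying `D - λ_{n+1}` kills `v_{n+1}` and turns the `X_{n+1}` term into a multiple of
    -- `v_{n+1}`.
    have hz : (z * ((1 + (s : ℂ) ^ 2) * (s * μ))) • v s μ (n + 1) = 0 := by
      rw [map_add, map_smul, map_smul, opK_v s μ hs, opK_X s μ hs] at h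
      have h' := sub_eq_zero.mpr h
      rw [← h']
      module
    rw [smul_eq_zero, mul_eq_zero] at hz
    have hv := (isGroupLikeElem_v s μ (n + 1)).ne_zero
    have hz' : z = 0 := by simpa [opK_X_coeff_ne_zero s μ hs hμ, hv] using hz
    exact ⟨y, by rw [hz', zero_smul, add_zero]⟩

theorem exists_finiteDimensional_stable (x : Rq s μ) : ∃ F : Submodule ℂ (Rq s μ),
    FiniteDimensional ℂ F ∧ (∀ y ∈ F, opK s μ y ∈ F) ∧ x ∈ F := by
  have hx : x ∈ ⨆ n, component s μ n := by rw [iSup_component s μ hs hμ]; trivial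
  induction hx using Submodule.iSup_induction' with
  | mem n y hy =>
    refine ⟨component s μ n, Submodule.finiteDimensional_of_le (component_le_homSpan s μ _),
      component_le s μ (N := (component s μ n).comap (opK s μ)) ?_ fun hn => ?_, hy⟩
    · rw [Submodule.mem_comap, opK_v s μ hs]
      exact Submodule.smul_mem _ _ (v_mem_component s μ n)
    · obtain ⟨n, rfl⟩ := Nat.exists_eq_succ_of_ne_zero hn
      rw [Submodule.mem_comap, Nat.succ_eq_add_one, opK_X s μ hs]
      refine Submodule.add_mem _ (Submodule.smul_mem _ _ ?_)
        (Submodule.smul_mem _ _ (v_mem_component s μ _))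
      rw [component_succ]
      exact Submodule.subset_span (by simp)
  | zero => exact ⟨⊥, inferInstance, by simp, by simp⟩
  | add y z _ _ hy hz =>
    obtain ⟨F, _, hF, hyF⟩ := hy
    obtain ⟨G, _, hG, hzG⟩ := hz
    refine ⟨F ⊔ G, inferInstance, ?_, Submodule.add_mem_sup hyF hzG⟩
    intro u hu
    obtain ⟨f, hf, g, hg, rfl⟩ := Submodule.mem_sup.mp hu
    rw [map_add]
    exact Submodule.add_mem_sup (hF f hf) (hG g hg)

/-- A nonzero subspace stable under `opK` contains some `v_n`. -/
theorem exists_v_mem {W : Submodule ℂ (Rq s μ)} (hW : W ≠ ⊥) (hD : ∀ x ∈ W, opK s μ x ∈ W) :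
    ∃ n, v s μ n ∈ W := by
  obtain ⟨x, hxW, hx⟩ := Submodule.exists_mem_ne_zero_of_ne_bot hW
  -- Local finiteness of `D` cuts `W` down to a nonzero finite-dimensional stable subspace, where an
  -- eigenvector exists over `ℂ`.
  obtain ⟨F, hF, hFD, hxF⟩ := exists_finiteDimensional_stable s μ hs hμ x
  have hmaps : ∀ y ∈ W ⊓ F, opK s μ y ∈ W ⊓ F := fun y hy => ⟨hD y hy.1, hFD y hy.2⟩
  have : FiniteDimensional ℂ (W ⊓ F : Submodule ℂ (Rq s μ)) :=
    Submodule.finiteDimensional_of_le inf_le_right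
  have : Nontrivial (W ⊓ F : Submodule ℂ (Rq s μ)) :=
    ⟨⟨x, hxW, hxF⟩, 0, fun h => hx (congrArg Subtype.val h)⟩
  obtain ⟨t, ht⟩ := Module.End.exists_eigenvalue ((opK s μ).restrict hmaps)
  obtain ⟨y, hy⟩ := ht.exists_hasEigenvector
  have hy1 : opK s μ y = t • (y : Rq s μ) := congrArg Subtype.val hy.apply_eq_smul
  have hy0 : (y : Rq s μ) ≠ 0 := fun h => hy.2 (Subtype.ext h)
  obtain ⟨n, -, z, hz⟩ := exists_eq_smul_v s μ hs hμ hy0 hy1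
  have hz0 : z ≠ 0 := by rintro rfl; exact hy0 (by rw [hz, zero_smul])
  refine ⟨n, ?_⟩
  have := W.smul_mem z⁻¹ y.2.1
  rwa [hz, smul_smul, inv_mul_cancel₀ hz0, one_smul] at this

end

end QuantumSL2

/-! ### General facts on tensors, group-like elements and Hopf algebras -/

theorem eq_zero_of_lTensor_eq_zero {V : Type*} [AddCommGroup V] [Module ℂ V] {f : V →ₗ[ℂ] V}
    {g : V →ₗ[ℂ] ℂ} (h : ∀ x, f x = 0 → g x = 0 → x = 0) {t : V ⊗[ℂ] V}
    (hf : f.lTensor V t = 0) (hg : g.lTensor V t = 0) : t = 0 := by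
  -- Joint injectivity of `f` and `g` gives a linear left inverse of `(f, g)`, and a left inverse
  -- survives tensoring.
  obtain ⟨p, hp⟩ := (f.prod g).exists_leftInverse_of_injective <| by
    rw [LinearMap.ker_eq_bot']
    intro x hx
    exact h x (congrArg Prod.fst hx) (congrArg Prod.snd hx)
  have hfg : f.prod g = LinearMap.inl ℂ V ℂ ∘ₗ f + LinearMap.inr ℂ V ℂ ∘ₗ g := by
    ext <;> simp
  have h1 : (p ∘ₗ f.prod g).lTensor V t = t := by rw [hp, LinearMap.lTensor_id]; rfl
  rw [← h1, LinearMap.lTensor_comp, hfg, LinearMap.lTensor_add, LinearMap.lTensor_comp,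
    LinearMap.lTensor_comp]
  simp [hf, hg]

theorem tmul_mem_range_map {C : Type*} [AddCommGroup C] [Module ℂ C]
    {D : Submodule ℂ C} {x y : C} (hx : x ∈ D) (hy : y ∈ D) :
    x ⊗ₜ[ℂ] y ∈ LinearMap.range (TensorProduct.map D.subtype D.subtype) :=
  ⟨(⟨x, hx⟩ : D) ⊗ₜ (⟨y, hy⟩ : D), by simp⟩

section Coalg

variable {C : Type*} [AddCommGroup C] [Module ℂ C] [Coalgebra ℂ C]

theorem isSubcoalgebra_span {S : Set C}
    (h : ∀ x ∈ S, Coalgebra.comul (R := ℂ) x ∈ LinearMap.range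
      (TensorProduct.map (Submodule.span ℂ S).subtype (Submodule.span ℂ S).subtype)) :
    IsSubcoalgebra (Submodule.span ℂ S) := fun _ hx =>
  (Submodule.span_le (p := (LinearMap.range (TensorProduct.map (Submodule.span ℂ S).subtype
    (Submodule.span ℂ S).subtype)).comap Coalgebra.comul)).mpr h hx

theorem IsGroupLikeElem.isSubcoalgebra_span {g : C} (hg : IsGroupLikeElem ℂ g) :
    IsSubcoalgebra (Submodule.span ℂ {g}) :=
  _root_.isSubcoalgebra_span <| by
    rintro _ rfl
    rw [hg.comul_eq_tmul_self]
    exact tmul_mem_range_map (Submodule.subset_span rfl) (Submodule.subset_span rfl)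

theorem IsGroupLikeElem.isSimpleSubcoalgebra_span {g : C} (hg : IsGroupLikeElem ℂ g) :
    IsSimpleSubcoalgebra (Submodule.span ℂ {g}) :=
  ⟨hg.isSubcoalgebra_span, by simpa using hg.ne_zero, fun _ _ hE =>
    (nonzero_span_atom g hg.ne_zero).le_iff.mp hE⟩

theorem IsGroupLikeElem.isUnitaryCorepresentation {g : C} (hg : IsGroupLikeElem ℂ g)
    {τ : C →ₛₗ[starRingEnd ℂ] C} (hτ : τ g = g) :
    IsUnitaryCorepresentation τ (oneDimCorep g) where
  coassoc x := by simp [oneDimCorep, hg.comul_eq_tmul_self]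
  counit x := by simp [oneDimCorep, hg.counit_eq_one]
  unitary x y := by
    simp [matrixCoeff, oneDimCorep, hτ, smul_smul, mul_comm]

/-- In a Hopf algebra, skew-primitive elements can be transported between group-likes. -/
theorem exists_primitive_over {H : Type*} [Ring H] [HopfAlgebra ℂ H] {g h x : H}
    (hg : IsGroupLikeElem ℂ g) (hh : IsGroupLikeElem ℂ h) (hx : x ≠ 0)
    (hΔ : Coalgebra.comul (R := ℂ) x = h ⊗ₜ x + x ⊗ₜ h) :
    ∃ y : H, y ≠ 0 ∧ Coalgebra.comul (R := ℂ) y = g ⊗ₜ y + y ⊗ₜ g := by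
  -- The antipode of `h` is its inverse, so `u = h⁻¹ g` is group-like and right multiplication by it
  -- carries `h` to `g`.
  set u := HopfAlgebra.antipode ℂ h * g with hu
  have hu' : IsGroupLikeElem ℂ u := hh.antipode.mul hg
  have hhu : h * u = g := by rw [hu, ← mul_assoc, hh.mul_antipode_cancel, one_mul]
  refine ⟨x * u, fun h0 => hx ?_, ?_⟩
  · exact hu'.isUnit.mul_left_eq_zero.mp h0
  · rw [Bialgebra.comul_mul, hΔ, hu'.comul_eq_tmul_self, add_mul,
      Algebra.TensorProduct.tmul_mul_tmul, Algebra.TensorProduct.tmul_mul_tmul, hhu]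

end Coalg

/-! ### Coproduct of `X_n`, simple subcoalgebras, and the absence of a Hopf structure -/

namespace QuantumSL2

open Gen SLq

variable (s : Circle) (μ : ℝ) (hs : ∀ n : ℕ, 0 < n → (s ^ 2) ^ n ≠ 1) (hμ : μ ≠ 0)
include hs hμ

/-- The difference of the two sides is killed by `id ⊗ (D - λ_{n+1})`, because `D` commutes with `Δ`
on the second leg, and by `id ⊗ ε`, because `ε(X_{n+1}) = 0`. These maps are jointly injective: the
kernel of `D - λ_{n+1}` consists of multiples of a group-like, on which `ε` is `1`. -/
theorem comul_X (n : ℕ) : Coalgebra.comul (R := ℂ) (X s μ (n + 1)) =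
    v s μ (n + 1) ⊗ₜ X s μ (n + 1) + X s μ (n + 1) ⊗ₜ v s μ (n + 1) := by
  rw [← sub_eq_zero]
  have hv := isGroupLikeElem_v s μ (n + 1)
  refine eq_zero_of_lTensor_eq_zero (f := opK s μ - eigval s μ (n + 1) • 1)
    (g := Coalgebra.counit) (fun x h1 h2 => ?_) ?_ ?_
  · by_contra hx
    obtain ⟨m, -, z, rfl⟩ := exists_eq_smul_v s μ hs hμ hx
      (t := eigval s μ (n + 1)) (by simpa [sub_eq_zero] using h1)
    rw [map_smul, (isGroupLikeElem_v s μ m).counit_eq_one, smul_eq_mul, mul_one] at h2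
    exact hx (by rw [h2, zero_smul])
  · have h1 : (opK s μ).lTensor _ (Coalgebra.comul (R := ℂ) (X s μ (n + 1))) =
        Coalgebra.comul (opK s μ (X s μ (n + 1))) := (comul_hit _ _).symm
    rw [LinearMap.lTensor_sub, LinearMap.sub_apply, map_sub (LinearMap.lTensor _ (opK s μ)), h1,
      opK_X s μ hs, LinearMap.lTensor_smul, Module.End.one_eq_id, LinearMap.lTensor_id]
    simp only [map_add, map_smul, LinearMap.lTensor_tmul, hv.comul_eq_tmul_self, opK_v s μ hs,
      opK_X s μ hs, LinearMap.smul_apply, LinearMap.id_apply, TensorProduct.tmul_add,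
      TensorProduct.tmul_smul]
    module
  · simp [counit_X, hv.counit_eq_one]

theorem isCocommSubcoalgebra_component (n : ℕ) :
    IsCocommSubcoalgebra (component s μ n) := by
  have hv := isGroupLikeElem_v s μ n
  have hvm := v_mem_component s μ n
  refine ⟨component_le s μ (N := (LinearMap.range (TensorProduct.map (component s μ n).subtype
    (component s μ n).subtype)).comap Coalgebra.comul) ?_ fun hn => ?_,
    component_le s μ (N := LinearMap.eqLocus ((TensorProduct.comm ℂ _ _).toLinearMap ∘ₗ
      Coalgebra.comul) Coalgebra.comul) ?_ fun hn => ?_⟩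
  · rw [Submodule.mem_comap, hv.comul_eq_tmul_self]
    exact tmul_mem_range_map hvm hvm
  · obtain ⟨n, rfl⟩ := Nat.exists_eq_succ_of_ne_zero hn
    have hX : X s μ (n + 1) ∈ component s μ (n + 1) := by
      rw [component_succ]
      exact Submodule.subset_span (by simp)
    rw [Submodule.mem_comap, Nat.succ_eq_add_one, comul_X s μ hs hμ]
    exact Submodule.add_mem _ (tmul_mem_range_map hvm hX) (tmul_mem_range_map hX hvm)
  · simp [LinearMap.mem_eqLocus, hv.comul_eq_tmul_self]
  · obtain ⟨n, rfl⟩ := Nat.exists_eq_succ_of_ne_zero hn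
    simp [LinearMap.mem_eqLocus, comul_X s μ hs hμ, add_comm]

/-- A subcoalgebra is stable under `opK`, hence contains some `v_n` if nonzero; simplicity then
forces it to be the line through `v_n`. -/
theorem isSimpleSubcoalgebra_iff (D : Submodule ℂ (Rq s μ)) :
    IsSimpleSubcoalgebra D ↔ ∃ n, D = Submodule.span ℂ {v s μ n} := by
  constructor
  · rintro ⟨hD, hne, hsimple⟩
    obtain ⟨n, hn⟩ := exists_v_mem s μ hs hμ hne fun x hx => hD.hit_mem _ hx
    refine ⟨n, ?_⟩
    have hv := isGroupLikeElem_v s μ n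
    rcases hsimple _ hv.isSubcoalgebra_span
      (Submodule.span_le.mpr (Set.singleton_subset_iff.mpr hn)) with h | h
    · exact absurd (Submodule.span_singleton_eq_bot.mp h) hv.ne_zero
    · exact h.symm
  · rintro ⟨n, rfl⟩
    exact (isGroupLikeElem_v s μ n).isSimpleSubcoalgebra_span

theorem isPointedCoalgebra_Rq : IsPointedCoalgebra (Rq s μ) := by
  intro D hD
  obtain ⟨n, rfl⟩ := (isSimpleSubcoalgebra_iff s μ hs hμ D).mp hD
  exact finrank_span_singleton (isGroupLikeElem_v s μ n).ne_zero

/-- The hypothesis gives `D x = Y(x) v_0 + λ_0 x`, so `x` lies in the generalized eigenspace of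
`λ_0`. That space is only the line through `v_0`: the component of index `0` has no `X`. -/
theorem eq_zero_of_comul_eq {x : Rq s μ}
    (h : Coalgebra.comul (R := ℂ) x = v s μ 0 ⊗ₜ x + x ⊗ₜ v s μ 0) : x = 0 := by
  by_contra hx
  have hv := isGroupLikeElem_v s μ 0
  have hD : opK s μ x = derivK s μ x • v s μ 0 + eigval s μ 0 • x := by
    rw [opK, hit_apply, h]
    simp [derivK_v s μ hs]
  obtain ⟨n, hn, hx'⟩ := exists_mem_component s μ hs hμ hx (t := eigval s μ 0) <| by
    rw [Module.End.mem_maxGenEigenspace]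
    refine ⟨2, ?_⟩
    rw [sq (opK s μ - _), Module.End.mul_apply]
    simp [hD, opK_v s μ hs]
  obtain rfl := eigval_injective s μ hs hμ hn
  rw [component_zero, Submodule.mem_span_singleton] at hx'
  obtain ⟨z, rfl⟩ := hx'
  -- For `x = z v_0`, the counit on the first leg turns the hypothesis into `z v_0 = z v_0 + z v_0`.
  have hε := congrArg (TensorProduct.lid ℂ _ ∘ (Coalgebra.counit (R := ℂ)).rTensor _) h
  simp [hv.counit_eq_one, hv.comul_eq_tmul_self] at hε
  rcases hε with h0 | h0
  · exact hx (by rw [h0, zero_smul])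
  · exact hv.ne_zero h0

theorem X_ne_zero (n : ℕ) : X s μ (n + 1) ≠ 0 := by
  intro h
  have h' := opK_sub_eigval_X s μ hs n
  rw [h, map_zero] at h'
  exact smul_ne_zero (opK_X_coeff_ne_zero s μ hs hμ) (isGroupLikeElem_v s μ (n + 1)).ne_zero h'.symm

/-- An isomorphism would let the multiplication of `H` move the nonzero `X_1`, primitive over `v_1`,
to a nonzero element primitive over `v_0`, contradicting `eq_zero_of_comul_eq`. -/
theorem isEmpty_coalgEquiv (H : Type*) [Ring H] [HopfAlgebra ℂ H] :
    IsEmpty (H ≃ₗc[ℂ] Rq s μ) := by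
  refine ⟨fun φ => ?_⟩
  have hΔ : Coalgebra.comul (R := ℂ) (φ.symm (X s μ 1)) =
      φ.symm (v s μ 1) ⊗ₜ φ.symm (X s μ 1) + φ.symm (X s μ 1) ⊗ₜ φ.symm (v s μ 1) := by
    rw [← CoalgHomClass.map_comp_comul_apply, comul_X s μ hs hμ 0]
    simp
  obtain ⟨y, hy, hΔy⟩ := exists_primitive_over ((isGroupLikeElem_v s μ 0).map φ.symm)
    ((isGroupLikeElem_v s μ 1).map φ.symm)
    (fun h => X_ne_zero s μ hs hμ 0 (by simpa using congrArg φ h)) hΔ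
  have h := eq_zero_of_comul_eq s μ hs hμ (x := φ y) <| by
    rw [← CoalgHomClass.map_comp_comul_apply, hΔy]
    simp
  exact hy (by simpa using congrArg φ.symm h)

end QuantumSL2

end

theorem mainTheorem1 (s : Circle) (hs : ∀ n : ℕ, 0 < n → (s ^ 2) ^ n ≠ 1)
    (μ : ℝ) (hμ : μ ≠ 0) :
    (DirectSum.IsInternal (QuantumSL2.component s μ) ∧
      ∀ n, IsCocommSubcoalgebra (QuantumSL2.component s μ n)) ∧
    ((∀ n, IsGroupLikeElem ℂ (QuantumSL2.v s μ n)) ∧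
      (∀ D : Submodule ℂ (QuantumSL2.Rq s μ),
        IsSimpleSubcoalgebra D ↔ ∃ n, D = Submodule.span ℂ {QuantumSL2.v s μ n}) ∧
      IsPointedCoalgebra (QuantumSL2.Rq s μ) ∧
      ∀ n, IsUnitaryCorepresentation (QuantumSL2.tauK s μ (μ ^ 2))
        (oneDimCorep (QuantumSL2.v s μ n))) ∧
    ∀ (H : Type*) [Ring H] [HopfAlgebra ℂ H], IsEmpty (H ≃ₗc[ℂ] QuantumSL2.Rq s μ) := by
  refine ⟨⟨QuantumSL2.isInternal_component s μ hs hμ,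
    QuantumSL2.isCocommSubcoalgebra_component s μ hs hμ⟩,
    ⟨QuantumSL2.isGroupLikeElem_v s μ, QuantumSL2.isSimpleSubcoalgebra_iff s μ hs hμ,
      QuantumSL2.isPointedCoalgebra_Rq s μ hs hμ, fun n => ?_⟩, fun H _ _ => ?_⟩
  · exact (QuantumSL2.isGroupLikeElem_v s μ n).isUnitaryCorepresentation
      (QuantumSL2.tauK_v s μ hμ n)
  · exact QuantumSL2.isEmpty_coalgEquiv s μ hs hμ H
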